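/- For a graph $G=(V,E)$ of bounded degree and $1\le p\le\infty$, let $S$ be the bounded operator on $\ell^p(V)$ (complex scalars) given by $(Sf)(u)=\sum_{v\sim u}f(v)$. The infinite tail is the graph with vertices $u_1,u_2,\dots$ in which $u_j\sim u_k$ if and only if $|j-k|=1$; its shift is denoted $T$. For a finite graph $H$ and a vertex $v_0$ of $H$, let $G_H$ be the graph obtained from the disjoint union of $H$ and the infinite tail by adding the edge $v_0u_1$. The essential spectrum of a bounded operator $A$ is the set of $\lambda\in\mathbb C$ such that $A-\lambda$ is not Fredholm. Let $\Lambda(H,v_0)$ be the set of all $\lambda\in\mathbb C$ such that either (a) $\lambda$ is an eigenvalue of the adjacency matrix of $H$ with an eigenvector that vanishes at $v_0$, or (b) $\lambda=b+1/b$ for some $b\in\mathbb C$ with $0<|b|<1$ for which there is $f:V(H)\to\mathbb C$ with $f(v_0)=1$, $\sum_{w\sim v_0}f(w)+b=\lambda f(v_0)$ and $\sum_{w\sim v}f(w)=\lambda f(v)$ for every vertex $v\ne v_0$ of $H$ (sums over neighbours in $H$). Let $1\le p\le\infty$. Then: 1. The spectrum and the essential spectrum of $T$ on $\ell^p$ are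 both equal to $[-2,2]$. 2. For every finite graph $H$ and every vertex $v_0$ of $H$, the essential spectrum of $S$ on $\ell^p(G_H)$ is $[-2,2]$, and the spectrum of $S$ is the union of $[-2,2]$ and the set of eigenvalues of $S$ on $\ell^p(G_H)$. If $p<\infty$, the set of eigenvalues is $\Lambda(H,v_0)$; and for all $1\le p\le\infty$ the spectrum is $[-2,2]\cup\Lambda(H,v_0)$. 3. In each of the following cases the spectrum of $S$ on $\ell^p(G_H)$ is $[-2,2]\cup\Lambda$ with the stated set $\Lambda$, and if $p<\infty$ then $\Lambda$ is the set of eigenvalues of $S$. * Kite: $H$ is the $(n+1)$-cycle, $n\ge2$, and $v_0$ is one of its vertices. If $n=2$, then $\Lambda=\{-1,\sqrt5\}$. If $n\ge3$, then $x^{n+1}+2x^2-1$ has exactly two roots in $(-1,1)$, namely one root $x_1\in(0,1)$ and one root $x_2\in(-1,0)$, and $\Lambda=\{2\cos(2\pi j/(n+1)) : 1\le j\le\lfloor n/2\rfloor\}\cup\{x_1+1/x_1,\;x_2+1/x_2\}$. * Fly-swatter: $H=K_{n+1}$, $n\ge2$, and $v_0$ is one of its vertices. Then $\Lambda=\{-1,\;b+1/b\}$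 with $b=\frac12\left(-1+\sqrt{\frac{n+3}{n-1}}\right)$. * Comb: $H$ has vertices $v_1,\dots,v_n,w_1,\dots,w_n$, $n\ge2$, and edges $v_jv_{j+1}$ ($1\le j\le n-1$) and $v_jw_j$ ($1\le j\le n$), and the tail is attached at $v_n$. Then $\Lambda=\{b+1/b : b\in\mathbb C,\ |b|<1,\ h_n(b)=0\}$, where $h_1=1$, $h_2(b)=-b^6-b^4+1$ and $h_n(b)=(b^4+b^2+1)h_{n-1}(b)-b^2(b^2+1)^2h_{n-2}(b)$ for $n\ge3$. -/

import Mathlib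

open scoped ENNReal Polynomial

noncomputable section

namespace InfiniteTail

universe u

variable {V : Type u}

/-! ### The shift operator on `ℓ^p` of a graph of bounded degree -/

/-- The shift operator on all functions: `(S f)(u) = ∑_{v ∼ u} f v`. -/
def shift (G : SimpleGraph V) [G.LocallyFinite] (f : V → ℂ) (u : V) : ℂ :=
  ∑ v ∈ G.neighborFinset u, f v

/-- The vertex degrees of `G` are bounded. -/
def HasBoundedDegree (G : SimpleGraph V) [G.LocallyFinite] : Prop :=
  ∃ D : ℕ, ∀ v, G.degree v ≤ D

theorem sum_norm_shift_rpow_le (G : SimpleGraph V) [G.LocallyFinite] {D : ℕ}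
    (hD : ∀ v, G.degree v ≤ D) {p : ℝ≥0∞} (hp : 1 ≤ p.toReal)
    (f : lp (fun _ : V => ℂ) p) (s : Finset V) :
    ∑ u ∈ s, ‖shift G f u‖ ^ p.toReal ≤ (D * ‖f‖) ^ p.toReal := by
  classical
  set r := p.toReal with hr
  have hr0 : 0 < r := by linarith
  have h1 : ∀ u ∈ s, ‖shift G f u‖ ^ r ≤
      (D : ℝ) ^ (r - 1) * ∑ v ∈ G.neighborFinset u, ‖f v‖ ^ r := by
    intro u _
    calc ‖shift G f u‖ ^ r ≤ (∑ v ∈ G.neighborFinset u, ‖f v‖) ^ r :=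
          Real.rpow_le_rpow (norm_nonneg _) (norm_sum_le _ _) hr0.le
      _ ≤ ((G.neighborFinset u).card : ℝ) ^ (r - 1) * ∑ v ∈ G.neighborFinset u, ‖f v‖ ^ r :=
          Real.rpow_sum_le_const_mul_sum_rpow_of_nonneg _ hp fun _ _ => norm_nonneg _
      _ ≤ _ := by
          refine mul_le_mul_of_nonneg_right ?_ (Finset.sum_nonneg fun _ _ => by positivity)
          refine Real.rpow_le_rpow (by positivity) ?_ (by linarith)
          rw [G.card_neighborFinset_eq_degree u]
          exact_mod_cast hD u
  set t := s.biUnion fun u => G.neighborFinset u with ht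
  have h2 : ∑ u ∈ s, ∑ v ∈ G.neighborFinset u, ‖f v‖ ^ r ≤ D * ∑ v ∈ t, ‖f v‖ ^ r := by
    have e : ∑ u ∈ s, ∑ v ∈ G.neighborFinset u, ‖f v‖ ^ r =
        ∑ v ∈ t, ∑ u ∈ s with G.Adj v u, ‖f v‖ ^ r := by
      refine Finset.sum_comm' fun u v => ?_
      simp only [SimpleGraph.mem_neighborFinset, Finset.mem_filter, ht, Finset.mem_biUnion]
      constructor
      · rintro ⟨hu, huv⟩
        exact ⟨⟨hu, huv.symm⟩, u, hu, huv⟩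
      · rintro ⟨⟨hu, hvu⟩, _⟩
        exact ⟨hu, hvu.symm⟩
    rw [e, Finset.mul_sum]
    refine Finset.sum_le_sum fun v _ => ?_
    rw [Finset.sum_const, nsmul_eq_mul]
    refine mul_le_mul_of_nonneg_right ?_ (by positivity)
    have : (s.filter fun u => G.Adj v u).card ≤ G.degree v := by
      rw [← G.card_neighborFinset_eq_degree v]
      refine Finset.card_le_card fun u hu => ?_
      simpa using (Finset.mem_filter.1 hu).2
    exact_mod_cast this.trans (hD v)
  calc ∑ u ∈ s, ‖shift G f u‖ ^ r
      ≤ ∑ u ∈ s, (D : ℝ) ^ (r - 1) * ∑ v ∈ G.neighborFinset u, ‖f v‖ ^ r := Finset.sum_le_sum h1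
    _ = (D : ℝ) ^ (r - 1) * ∑ u ∈ s, ∑ v ∈ G.neighborFinset u, ‖f v‖ ^ r := by
        rw [Finset.mul_sum]
    _ ≤ (D : ℝ) ^ (r - 1) * (D * ‖f‖ ^ r) := by
        refine mul_le_mul_of_nonneg_left (h2.trans ?_) (by positivity)
        exact mul_le_mul_of_nonneg_left (lp.sum_rpow_le_norm_rpow hr0 f t) (by positivity)
    _ = (D * ‖f‖) ^ r := by
        rw [Real.mul_rpow (by positivity) (lp.norm_nonneg' f), ← mul_assoc]
        congr 1
        rcases Nat.eq_zero_or_pos D with rfl | h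
        · simp [Real.zero_rpow hr0.ne']
        · have hD0 : (0 : ℝ) < D := by exact_mod_cast h
          rw [Real.rpow_sub_one hD0.ne']
          field_simp

theorem norm_shift_apply_le (G : SimpleGraph V) [G.LocallyFinite] {D : ℕ}
    (hD : ∀ v, G.degree v ≤ D) (f : lp (fun _ : V => ℂ) ∞) (u : V) :
    ‖shift G f u‖ ≤ D * ‖f‖ := by
  calc ‖shift G f u‖ ≤ ∑ v ∈ G.neighborFinset u, ‖f‖ :=
        norm_sum_le_of_le _ fun v _ => lp.norm_apply_le_norm ENNReal.top_ne_zero f v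
    _ = G.degree u * ‖f‖ := by
        rw [Finset.sum_const, nsmul_eq_mul, G.card_neighborFinset_eq_degree u]
    _ ≤ D * ‖f‖ := mul_le_mul_of_nonneg_right (by exact_mod_cast hD u) (norm_nonneg _)

theorem one_le_toReal {p : ℝ≥0∞} (h1 : 1 ≤ p) (hp : p ≠ ∞) : 1 ≤ p.toReal := by
  simpa using ENNReal.toReal_mono hp h1

theorem memℓp_shift (G : SimpleGraph V) [G.LocallyFinite] (hG : HasBoundedDegree G)
    (p : ℝ≥0∞) [h1 : Fact (1 ≤ p)] (f : lp (fun _ : V => ℂ) p) : Memℓp (shift G f) p := by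
  obtain ⟨D, hD⟩ := hG
  rcases eq_or_ne p ∞ with rfl | hp
  · refine memℓp_infty ⟨D * ‖f‖, ?_⟩
    rintro _ ⟨u, rfl⟩
    exact norm_shift_apply_le G hD f u
  · exact memℓp_gen' (sum_norm_shift_rpow_le G hD (one_le_toReal h1.out hp) f)

/-- The shift operator as a bounded operator on `ℓ^p(G)`, for a graph of bounded degree. -/
def shiftLp (G : SimpleGraph V) [G.LocallyFinite] (hG : HasBoundedDegree G)
    (p : ℝ≥0∞) [Fact (1 ≤ p)] :
    lp (fun _ : V => ℂ) p →L[ℂ] lp (fun _ : V => ℂ) p :=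
  LinearMap.mkContinuousOfExistsBound
    { toFun := fun f => ⟨shift G f, memℓp_shift G hG p f⟩
      map_add' := fun f g => by
        ext u
        exact Finset.sum_add_distrib
      map_smul' := fun c f => by
        ext u
        exact (Finset.mul_sum _ _ _).symm }
    (by
      have h1 : 1 ≤ p := Fact.out
      obtain ⟨D, hD⟩ := hG
      refine ⟨D, fun f => ?_⟩
      rcases eq_or_ne p ∞ with rfl | hp
      · exact lp.norm_le_of_forall_le (by positivity) (norm_shift_apply_le G hD f)
      · have h := one_le_toReal h1 hp
        exact lp.norm_le_of_forall_sum_le (by linarith) (by positivity)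
          (sum_norm_shift_rpow_le G hD h f))

theorem shiftLp_apply (G : SimpleGraph V) [G.LocallyFinite] (hG : HasBoundedDegree G)
    (p : ℝ≥0∞) [Fact (1 ≤ p)] (f : lp (fun _ : V => ℂ) p) (u : V) :
    shiftLp G hG p f u = ∑ v ∈ G.neighborFinset u, f v := rfl

/-! ### Parts of the spectrum -/

section Spectra

variable {E : Type*} [NormedAddCommGroup E] [NormedSpace ℂ E]

/-- The set of eigenvalues of a bounded operator. -/
def pointSpectrum (A : E →L[ℂ] E) : Set ℂ :=
  {z | Module.End.HasEigenvalue (A : E →ₗ[ℂ] E) z}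

/-- The essential spectrum: the `z` such that `A - z` is not a Fredholm operator. -/
def essentialSpectrum (A : E →L[ℂ] E) : Set ℂ :=
  {z | ¬ (A - z • ContinuousLinearMap.id ℂ E).IsFredholm}

end Spectra

/-- The real interval `[-2, 2]`, as a subset of `ℂ`. -/
def band : Set ℂ := ((↑) : ℝ → ℂ) '' Set.Icc (-2) 2

/-! ### The infinite tail, and a finite graph with an infinite tail -/

/-- The infinite tail: `j ∼ k` if and only if `|j - k| = 1`. The number `k` stands for `u_{k+1}`. -/
def tail : SimpleGraph ℕ where
  Adj j k := j + 1 = k ∨ k + 1 = j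
  symm := ⟨fun _ _ h => h.symm⟩
  loopless := ⟨fun k h => by omega⟩

/-- The adjacency relation of `H` with an infinite tail: `Sum.inl v` is the vertex `v` of `H`, and
`Sum.inr k` is the vertex `u_{k+1}` of the tail. The only edge between them joins `v₀` and `u_1`. -/
def attachTailAdj (H : SimpleGraph V) (v₀ : V) : V ⊕ ℕ → V ⊕ ℕ → Prop
  | Sum.inl a, Sum.inl b => H.Adj a b
  | Sum.inl a, Sum.inr k => a = v₀ ∧ k = 0
  | Sum.inr k, Sum.inl a => a = v₀ ∧ k = 0
  | Sum.inr j, Sum.inr k => tail.Adj j k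

/-- The graph obtained from `H` by attaching an infinite tail to the vertex `v₀`. -/
def attachTail (H : SimpleGraph V) (v₀ : V) : SimpleGraph (V ⊕ ℕ) where
  Adj := attachTailAdj H v₀
  symm := ⟨by
    rintro (a | j) (b | k) h
    · exact SimpleGraph.Adj.symm (G := H) h
    · exact h
    · exact h
    · exact SimpleGraph.Adj.symm (G := tail) h⟩
  loopless := ⟨by
    rintro (a | j) h
    · exact H.irrefl h
    · exact tail.irrefl h⟩

theorem tail_neighborSet_subset (k : ℕ) :
    tail.neighborSet k ⊆ (({k - 1, k + 1} : Finset ℕ) : Set ℕ) := by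
  intro j hj
  have hj' : k + 1 = j ∨ j + 1 = k := hj
  simp only [Finset.coe_insert, Finset.coe_singleton, Set.mem_insert_iff, Set.mem_singleton_iff]
  omega

instance tailLocallyFinite : tail.LocallyFinite := fun k =>
  ((Finset.finite_toSet _).subset (tail_neighborSet_subset k)).fintype

theorem tail_hasBoundedDegree : HasBoundedDegree tail := by
  refine ⟨2, fun k => ?_⟩
  rw [← tail.card_neighborFinset_eq_degree k]
  refine (Finset.card_le_card (t := {k - 1, k + 1}) fun j hj => ?_).trans Finset.card_le_two
  exact_mod_cast tail_neighborSet_subset k (by simpa using hj)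

open Classical in
theorem attachTail_neighborSet_subset [Fintype V] (H : SimpleGraph V) (v₀ : V) (x : V ⊕ ℕ) :
    (attachTail H v₀).neighborSet x ⊆
      ((Finset.univ.image Sum.inl ∪ {Sum.inr 0, Sum.inr (x.elim (fun _ => 0) id - 1),
        Sum.inr (x.elim (fun _ => 0) id + 1)} : Finset (V ⊕ ℕ)) : Set (V ⊕ ℕ)) := by
  intro y hy
  have hy' : attachTailAdj H v₀ x y := hy
  rcases y with b | k
  · simp
  · rcases x with a | j
    · have : k = 0 := hy'.2
      simp [this]
    · have : j + 1 = k ∨ k + 1 = j := hy'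
      simp
      omega

instance attachTailLocallyFinite [Fintype V] (H : SimpleGraph V) (v₀ : V) :
    (attachTail H v₀).LocallyFinite := fun x =>
  ((Finset.finite_toSet _).subset (attachTail_neighborSet_subset H v₀ x)).fintype

theorem attachTail_hasBoundedDegree [Fintype V] (H : SimpleGraph V) (v₀ : V) :
    HasBoundedDegree (attachTail H v₀) := by
  classical
  refine ⟨Fintype.card V + 3, fun x => ?_⟩
  rw [← (attachTail H v₀).card_neighborFinset_eq_degree x]
  refine (Finset.card_le_card (t := Finset.univ.image Sum.inl ∪ {Sum.inr 0,
    Sum.inr (x.elim (fun _ => 0) id - 1), Sum.inr (x.elim (fun _ => 0) id + 1)}) fun y hy => ?_).trans ?_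
  · have h := attachTail_neighborSet_subset H v₀ x (by simpa using hy)
    convert Finset.mem_coe.1 h
  · exact (Finset.card_union_le _ _).trans
      (add_le_add (Finset.card_image_le.trans le_rfl) Finset.card_le_three)

/-- The shift `T` of the infinite tail on `ℓ^p`. -/
def tailShift (p : ℝ≥0∞) [Fact (1 ≤ p)] :
    lp (fun _ : ℕ => ℂ) p →L[ℂ] lp (fun _ : ℕ => ℂ) p :=
  shiftLp tail tail_hasBoundedDegree p

/-- The shift `S` on `ℓ^p` of the finite graph `H` with an infinite tail attached at `v₀`. -/
def attachTailShift [Fintype V] (H : SimpleGraph V) (v₀ : V) (p : ℝ≥0∞) [Fact (1 ≤ p)] :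
    lp (fun _ : V ⊕ ℕ => ℂ) p →L[ℂ] lp (fun _ : V ⊕ ℕ => ℂ) p :=
  shiftLp (attachTail H v₀) (attachTail_hasBoundedDegree H v₀) p

/-- The numbers given by the two finite systems of equations on `H`: the eigenvalues of the
adjacency matrix of `H` that have an eigenvector vanishing at `v₀`; and the `b + 1/b` with
`0 < |b| < 1` for which the eigenvalue equations at the vertices of `H` are solvable with
`f(v₀) = 1` and the value `b` at the first vertex of the tail. -/
def finiteSystemEigenvalues (H : SimpleGraph V) [H.LocallyFinite] (v₀ : V) : Set ℂ :=
  {z | ∃ f : V → ℂ, f ≠ 0 ∧ f v₀ = 0 ∧ ∀ v, shift H f v = z * f v} ∪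
  {z | ∃ b : ℂ, b ≠ 0 ∧ ‖b‖ < 1 ∧ z = b + 1 / b ∧ ∃ f : V → ℂ, f v₀ = 1 ∧
    shift H f v₀ + b = z * f v₀ ∧ ∀ v, v ≠ v₀ → shift H f v = z * f v}

/-! ### The three families of examples -/

/-- The kite: the `(n+1)`-cycle with an infinite tail. -/
def kiteShift (n : ℕ) (p : ℝ≥0∞) [Fact (1 ≤ p)] :
    lp (fun _ : Fin (n + 1) ⊕ ℕ => ℂ) p →L[ℂ] lp (fun _ : Fin (n + 1) ⊕ ℕ => ℂ) p :=
  attachTailShift (SimpleGraph.cycleGraph (n + 1)) 0 p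

/-- The fly-swatter: the complete graph on `n + 1` vertices with an infinite tail. -/
def flySwatterShift (n : ℕ) (p : ℝ≥0∞) [Fact (1 ≤ p)] :
    lp (fun _ : Fin (n + 1) ⊕ ℕ => ℂ) p →L[ℂ] lp (fun _ : Fin (n + 1) ⊕ ℕ => ℂ) p :=
  attachTailShift (⊤ : SimpleGraph (Fin (n + 1))) 0 p

/-- The adjacency relation of the finite comb: `Sum.inl j` is `v_{j+1}` and `Sum.inr j` is
`w_{j+1}`. -/
def combAdj (n : ℕ) : Fin n ⊕ Fin n → Fin n ⊕ Fin n → Prop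
  | Sum.inl i, Sum.inl j => (i : ℕ) + 1 = j ∨ (j : ℕ) + 1 = i
  | Sum.inl i, Sum.inr j => i = j
  | Sum.inr i, Sum.inl j => i = j
  | Sum.inr _, Sum.inr _ => False

/-- The finite comb: a path `v_1, …, v_n` with a pendant vertex `w_j` at each `v_j`. -/
def comb (n : ℕ) : SimpleGraph (Fin n ⊕ Fin n) where
  Adj := combAdj n
  symm := ⟨by
    rintro (i | i) (j | j) h
    · exact Or.symm h
    · exact Eq.symm h
    · exact Eq.symm h
    · exact h⟩
  loopless := ⟨by
    rintro (i | i) h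
    · have h' : (i : ℕ) + 1 = i ∨ (i : ℕ) + 1 = i := h
      omega
    · exact h⟩

/-- The comb with an infinite tail attached at the last vertex `v_n`. -/
def combShift (n : ℕ) (hn : 2 ≤ n) (p : ℝ≥0∞) [Fact (1 ≤ p)] :
    lp (fun _ : (Fin n ⊕ Fin n) ⊕ ℕ => ℂ) p →L[ℂ] lp (fun _ : (Fin n ⊕ Fin n) ⊕ ℕ => ℂ) p :=
  attachTailShift (comb n) (Sum.inl ⟨n - 1, by omega⟩) p

/-- The eigenvalues `2 cos (2πj/(n+1))`, `1 ≤ j ≤ ⌊n/2⌋`, of the kite. -/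
def kiteCosines (n : ℕ) : Set ℂ :=
  {z | ∃ j : ℕ, 1 ≤ j ∧ j ≤ n / 2 ∧ z = ((2 * Real.cos (2 * Real.pi * j / (n + 1)) : ℝ) : ℂ)}

/-- The positive root `b` of `(n-1) b² + (n-1) b - 1`. -/
def flySwatterRoot (n : ℕ) : ℝ :=
  (-1 + Real.sqrt (((n : ℝ) + 3) / ((n : ℝ) - 1))) / 2

/-- The polynomials `h_n` of the comb, for `n ≥ 1`; the value at `0` plays no role. -/
def combPoly : ℕ → ℂ[X]
  | 0 => 1
  | 1 => 1
  | 2 => -Polynomial.X ^ 6 - Polynomial.X ^ 4 + 1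
  | n + 3 => (Polynomial.X ^ 4 + Polynomial.X ^ 2 + 1) * combPoly (n + 2) -
      Polynomial.X ^ 2 * (Polynomial.X ^ 2 + 1) ^ 2 * combPoly (n + 1)

/-- The numbers `b + 1/b`, for the roots `b` of `h_n` of modulus less than one. -/
def combEigenvalues (n : ℕ) : Set ℂ :=
  {z | ∃ b : ℂ, ‖b‖ < 1 ∧ (combPoly n).eval b = 0 ∧ z = b + 1 / b}

end InfiniteTail

end

open scoped ENNReal Polynomial

noncomputable section

namespace InfiniteTail

/-! ### Fredholm operators, finite-rank perturbations and separated sequences -/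

section Abstract

open LinearMap.FiniteRangeSetoid

variable {E F : Type*} [NormedAddCommGroup E] [NormedSpace ℂ E]
  [NormedAddCommGroup F] [NormedSpace ℂ F]

/-! On the tail, `T = L + R` with the left and right translations, and `LR = 1` gives `T - (b + 1/b)
= -b⁻¹ (1 - bL)(1 - bR)`. Every `z` is `b + 1/b` with `0 < |b| ≤ 1`, and `z` lies in the band when
`|b| = 1`. For `|b| < 1` both factors are inverted by Neumann series. For `|b| = 1`, far translates
of a long tent modulated by `b ^ k` are separated by at least the norm of the tent, while `T - z`
shrinks them by a factor of order `1/q`. A Fredholm operator, being left invertible up to a compact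
operator, cannot do this (`exists_separation_le_of_isFredholm`). The argument is uniform in `p`,
including `p = ∞`.

With a finite graph attached, `S - z` agrees up to finite rank with the extension by zero of `T -
z`, so the essential spectrum is unchanged. Outside the band `S - z` is a finite-rank perturbation
of an invertible operator, and by the Fredholm alternative it is invertible as soon as it is
injective; so only eigenvalues are added.

Along `v₀, u_1, u_2, …` an eigenvector satisfies `a_k + a_{k+2} = z a_{k+1}`, and `b ^ k (a_{k+1} -
b a_k)` does not depend on `k` (`recursion_sub_mul_eq`). Hence a bounded solution is `b ^ k a_0` if
`|b| < 1`, and a solution tending to zero vanishes if `|b| = 1`. The eigenvalue problem becomes the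
finite system on `H`. For `p = ∞` there can be further eigenvalues, but only in the band, where they
do not affect the spectrum.

For the three families the finite system is solved by hand: the same invariant runs around the
cycle; on the complete graph everything is governed by the total sum of `f`; on the comb the pendant
vertices are eliminated, leaving a three-term recursion with parameter `z - 1/z`. -/

theorem isCompactOperator_of_hasFiniteRange (K : E →L[ℂ] F)
    (hK : (K : E →ₗ[ℂ] F).HasFiniteRange) : IsCompactOperator K := by
  have hfd : FiniteDimensional ℂ (K : E →ₗ[ℂ] F).range :=
    Module.Finite.of_fg hK
  have h1 : IsCompactOperator (_root_.id : (K : E →ₗ[ℂ] F).range → (K : E →ₗ[ℂ] F).range) :=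
    (isCompactOperator_id_iff_finiteDimensional (𝕜 := ℂ)).2 hfd
  have h2 := (h1.comp_clm (K.codRestrict (K : E →ₗ[ℂ] F).range fun x => ⟨x, rfl⟩)).clm_comp
    (K : E →ₗ[ℂ] F).range.subtypeL
  exact h2

/-- A Fredholm operator cannot be small along a bounded separated sequence. -/
theorem exists_separation_le_of_isFredholm {A : E →L[ℂ] F} (hA : A.IsFredholm) :
    ∃ K : ℝ, 0 ≤ K ∧ ∀ (x : ℕ → E) (C c ε : ℝ), (∀ i, ‖x i‖ ≤ C) →
      (∀ i j, i < j → c ≤ ‖x i - x j‖) → (∀ i, ‖A (x i)‖ ≤ ε) → c ≤ K * ε := by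
  obtain ⟨Q, hQ, -⟩ := hA.exists_isQuasiInverse
  set D : E →L[ℂ] E := Q ∘L A - ContinuousLinearMap.id ℂ E with hD
  have hDc : IsCompactOperator D := by
    refine isCompactOperator_of_hasFiniteRange D ?_
    exact equiv_iff_hasFiniteRange.1 hQ
  refine ⟨2 * ‖Q‖, by positivity, fun x C c ε hC hc hε => ?_⟩
  have hcomp := hDc.isCompact_closure_image_closedBall (f := (D : E →ₗ[ℂ] E)) C
  obtain ⟨a, -, φ, hφ, ha⟩ := hcomp.tendsto_subseq (x := fun i => D (x i)) fun i =>
    subset_closure ⟨x i, by simpa using hC i, rfl⟩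
  refine le_of_forall_pos_le_add fun δ hδ => ?_
  have hcau := ha.cauchySeq
  obtain ⟨N, hN⟩ := Metric.cauchySeq_iff'.1 hcau δ hδ
  have h1 := hN (N + 1) (by omega)
  set i := φ N
  set j := φ (N + 1)
  have hij : i < j := hφ (by omega)
  -- This is `QA = 1 + D`. The `D` terms are close to each other because `D` is compact and `i`, `j`
  -- are taken far out in a subsequence along which `D (x i)` converges.
  have h2 : x i - x j = Q (A (x i) - A (x j)) + (D (x j) - D (x i)) := by
    simp only [hD, sub_apply, ContinuousLinearMap.comp_apply,
      ContinuousLinearMap.id_apply, map_sub]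
    abel
  calc c ≤ ‖x i - x j‖ := hc i j hij
    _ ≤ ‖Q (A (x i) - A (x j))‖ + ‖D (x j) - D (x i)‖ := by rw [h2]; exact norm_add_le _ _
    _ ≤ ‖Q‖ * (ε + ε) + δ := by
        refine add_le_add ((Q.le_opNorm _).trans ?_) ?_
        · exact mul_le_mul_of_nonneg_left
            ((norm_sub_le _ _).trans (add_le_add (hε i) (hε j))) (norm_nonneg _)
        · rw [← dist_eq_norm]; exact h1.le
    _ = 2 * ‖Q‖ * ε + δ := by ring

theorem isFredholm_of_isUnit {A : E →L[ℂ] E} (hA : IsUnit A) : A.IsFredholm := by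
  obtain ⟨u, rfl⟩ := hA
  refine ContinuousLinearMap.IsFredholm.of_isQuasiInverse (v := (↑u⁻¹ : E →L[ℂ] E)) ⟨?_, ?_⟩
  · have h : ((↑u⁻¹ : E →L[ℂ] E) : E →ₗ[ℂ] E) ∘ₗ ((u : E →L[ℂ] E) : E →ₗ[ℂ] E) = .id :=
      congrArg ContinuousLinearMap.toLinearMap u.inv_mul
    rw [LinearMap.IsLeftQuasiInverse, h]
  · have h : ((u : E →L[ℂ] E) : E →ₗ[ℂ] E) ∘ₗ ((↑u⁻¹ : E →L[ℂ] E) : E →ₗ[ℂ] E) = .id :=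
      congrArg ContinuousLinearMap.toLinearMap u.mul_inv
    rw [LinearMap.IsRightQuasiInverse, h]

theorem isUnit_sub_of_notMem_spectrum {A : E →L[ℂ] E} {z : ℂ} (hz : z ∉ spectrum ℂ A) :
    IsUnit (A - z • ContinuousLinearMap.id ℂ E) := by
  rw [spectrum.notMem_iff] at hz
  have h := hz.neg
  rwa [neg_sub, Algebra.algebraMap_eq_smul_one] at h

theorem notMem_spectrum_of_isUnit_sub {A : E →L[ℂ] E} {z : ℂ}
    (hz : IsUnit (A - z • ContinuousLinearMap.id ℂ E)) : z ∉ spectrum ℂ A := by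
  rw [spectrum.notMem_iff]
  have h := hz.neg
  rwa [neg_sub] at h

theorem essentialSpectrum_subset_spectrum (A : E →L[ℂ] E) :
    essentialSpectrum A ⊆ spectrum ℂ A := by
  intro z hz
  by_contra h
  exact hz (isFredholm_of_isUnit (isUnit_sub_of_notMem_spectrum h))

theorem mem_pointSpectrum_iff {A : E →L[ℂ] E} {z : ℂ} :
    z ∈ pointSpectrum A ↔ ∃ x, x ≠ 0 ∧ A x = z • x := by
  constructor
  · intro h
    obtain ⟨x, hx⟩ := Module.End.HasEigenvalue.exists_hasEigenvector h
    exact ⟨x, hx.2, hx.apply_eq_smul⟩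
  · rintro ⟨x, hx, hAx⟩
    exact Module.End.hasEigenvalue_of_hasEigenvector
      (Module.End.hasEigenvector_iff.2 ⟨Module.End.mem_eigenspace_iff.2 hAx, hx⟩)

theorem pointSpectrum_subset_spectrum (A : E →L[ℂ] E) : pointSpectrum A ⊆ spectrum ℂ A := by
  intro z hz
  by_contra h
  obtain ⟨x, hx, hAx⟩ := mem_pointSpectrum_iff.1 hz
  obtain ⟨u, hu⟩ := isUnit_sub_of_notMem_spectrum h
  refine hx ?_
  have h1 : (u : E →L[ℂ] E) x = 0 := by rw [hu]; simp [hAx]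
  have h2 : ((↑u⁻¹ : E →L[ℂ] E) * (u : E →L[ℂ] E)) x = 0 := by
    rw [mul_apply_eq_comp, h1, map_zero]
  simpa using h2

/-- An injective finite-rank perturbation of an invertible operator is invertible. -/
theorem isUnit_of_injective_of_hasFiniteRange_sub [CompleteSpace E] {A B : E →L[ℂ] E}
    (hB : IsUnit B) (hAB : ((A - B : E →L[ℂ] E) : E →ₗ[ℂ] E).HasFiniteRange)
    (hA : ∀ x, A x = 0 → x = 0) : IsUnit A := by
  obtain ⟨u, rfl⟩ := hB
  set K : E →L[ℂ] E := (↑u⁻¹ : E →L[ℂ] E) * ((u : E →L[ℂ] E) - A) with hK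
  have hKc : IsCompactOperator K := by
    refine isCompactOperator_of_hasFiniteRange K ?_
    have h := hAB.neg.comp_left ((↑u⁻¹ : E →L[ℂ] E) : E →ₗ[ℂ] E)
    have e : (K : E →ₗ[ℂ] E) = ((↑u⁻¹ : E →L[ℂ] E) : E →ₗ[ℂ] E) ∘ₗ
        (-((A - u : E →L[ℂ] E) : E →ₗ[ℂ] E)) := by
      ext x
      simp [hK]
    rw [e]
    exact h
  have hAK : A = u * (1 - K) := by
    rw [hK, mul_sub, mul_one, Units.mul_inv_cancel_left, sub_sub_cancel]
  -- Fredholm alternative for the compact `K`: a fixed vector of `K` would lie in the kernel of `A =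
  -- u (1 - K)`.
  rcases hKc.hasEigenvalue_or_mem_resolventSet (μ := (1 : ℂ)) one_ne_zero with h | h
  · exfalso
    obtain ⟨x, hx⟩ := Module.End.HasEigenvalue.exists_hasEigenvector h
    refine hx.2 (hA x ?_)
    have h1 : K x = x := by simpa using hx.apply_eq_smul
    rw [hAK]
    simp [h1]
  · rw [hAK]
    have h1 : IsUnit (algebraMap ℂ (E →L[ℂ] E) 1 - K) := h
    rw [map_one] at h1
    exact u.isUnit.mul h1

/-- If `J` and `P` are inverse to each other up to finite rank, and `A` agrees with `J ∘ B ∘ P` up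
to finite rank, then `A` is Fredholm if and only if `B` is. -/
theorem isFredholm_iff_of_quasiInverse {A : E →L[ℂ] E} {B : F →L[ℂ] F} {J : F →L[ℂ] E}
    {P : E →L[ℂ] F} (hPJ : P ∘L J = ContinuousLinearMap.id ℂ F)
    (hJP : ((ContinuousLinearMap.id ℂ E - J ∘L P : E →L[ℂ] E) : E →ₗ[ℂ] E).HasFiniteRange)
    (hAB : ((A - J ∘L B ∘L P : E →L[ℂ] E) : E →ₗ[ℂ] E).HasFiniteRange) :
    A.IsFredholm ↔ B.IsFredholm := by
  have e0 : (P : E →ₗ[ℂ] F) ∘ₗ (J : F →ₗ[ℂ] E) = .id :=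
    congrArg ContinuousLinearMap.toLinearMap hPJ
  have hq : (P : E →ₗ[ℂ] F).IsQuasiInverse (J : F →ₗ[ℂ] E) := by
    refine ⟨?_, ?_⟩
    · rw [LinearMap.IsLeftQuasiInverse, e0]
    · exact Setoid.symm (equiv_iff_hasFiniteRange.2 hJP)
  have hA : (A : E →ₗ[ℂ] E) ≈ (J : F →ₗ[ℂ] E) ∘ₗ (B : F →ₗ[ℂ] F) ∘ₗ (P : E →ₗ[ℂ] F) :=
    equiv_iff_hasFiniteRange.2 hAB
  rw [ContinuousLinearMap.isFredholm_iff_exists_isQuasiInverse,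
    ContinuousLinearMap.isFredholm_iff_exists_isQuasiInverse]
  constructor
  · rintro ⟨Q, hQ⟩
    refine ⟨P ∘L Q ∘L J, ?_⟩
    -- `PQJ` is a quasi-inverse of `PAJ`, and up to finite rank `PAJ` is `PJBPJ = B`.
    have h1 : (((P : E →ₗ[ℂ] F) ∘ₗ (Q : E →ₗ[ℂ] E)) ∘ₗ (J : F →ₗ[ℂ] E)).IsQuasiInverse
        ((P : E →ₗ[ℂ] F) ∘ₗ (A : E →ₗ[ℂ] E) ∘ₗ (J : F →ₗ[ℂ] E)) :=
      LinearMap.IsQuasiInverse.comp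
        (hu := LinearMap.IsQuasiInverse.comp (hu := hq) (hv := hQ)) (hv := hq.symm)
    refine h1.congr (Setoid.refl _) ?_
    have h2 := equiv_comp_left (u' := (P : E →ₗ[ℂ] F)) (equiv_comp_right (u := (J : F →ₗ[ℂ] E)) hA)
    refine Setoid.trans ?_ (Setoid.symm h2)
    have h3 : (P : E →ₗ[ℂ] F) ∘ₗ (((J : F →ₗ[ℂ] E) ∘ₗ (B : F →ₗ[ℂ] F) ∘ₗ (P : E →ₗ[ℂ] F)) ∘ₗ
        (J : F →ₗ[ℂ] E)) = B := by
      have e1 : ∀ y, P (J y) = y := fun y => DFunLike.congr_fun hPJ y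
      ext y
      simp [e1]
    rw [h3]
  · rintro ⟨Q, hQ⟩
    refine ⟨J ∘L Q ∘L P, ?_⟩
    have h1 : (((J : F →ₗ[ℂ] E) ∘ₗ (Q : F →ₗ[ℂ] F)) ∘ₗ (P : E →ₗ[ℂ] F)).IsQuasiInverse
        ((J : F →ₗ[ℂ] E) ∘ₗ (B : F →ₗ[ℂ] F) ∘ₗ (P : E →ₗ[ℂ] F))   :=
      LinearMap.IsQuasiInverse.comp
        (hu := LinearMap.IsQuasiInverse.comp (hu := hq.symm) (hv := hQ)) (hv := hq)
    exact h1.congr (Setoid.refl _) hA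

end Abstract

/-! ### Operators on `ℓ^p` induced by partial injections -/

section Pullback

variable {α β : Type*} {φ : α → Option β}

/-- No two points of `α` are mapped to the same point of `β` by the partial map `φ`. -/
def PartialInjective (φ : α → Option β) : Prop :=
  ∀ a₁ a₂ b, φ a₁ = some b → φ a₂ = some b → a₁ = a₂

/-- The pullback of a function along a partial map, with value zero where the map is undefined. -/
def pullback (φ : α → Option β) (f : β → ℂ) (a : α) : ℂ := (φ a).elim 0 f

/-- By injectivity the sum reindexes over the image of `s`; points where `φ` is undefined contribute
`0 ^ r = 0`, which needs `r ≠ 0`. -/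
theorem sum_norm_pullback_rpow_le (hφ : PartialInjective φ) {r : ℝ} (hr : 0 < r) (f : β → ℂ)
    (s : Finset α) : ∃ t : Finset β, ∑ a ∈ s, ‖pullback φ f a‖ ^ r ≤ ∑ b ∈ t, ‖f b‖ ^ r := by
  classical
  refine ⟨Finset.eraseNone ((s.filter fun a => (φ a).isSome).image φ), ?_⟩
  rw [Finset.sum_eraseNone]
  refine le_of_eq ?_
  rw [Finset.sum_image]
  · rw [Finset.sum_filter]
    refine Finset.sum_congr rfl fun a _ => ?_
    unfold pullback
    rcases h : φ a with _ | b <;> simp [Real.zero_rpow hr.ne']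
  · intro a ha a' ha' h
    obtain ⟨b, hb⟩ := Option.isSome_iff_exists.1 (Finset.mem_filter.1 ha).2
    exact hφ a a' b hb (h ▸ hb)

theorem norm_pullback_apply_le (φ : α → Option β) {p : ℝ≥0∞} (hp : p ≠ 0)
    (f : lp (fun _ : β => ℂ) p) (a : α) : ‖pullback φ f a‖ ≤ ‖f‖ := by
  unfold pullback
  rcases φ a with _ | b
  · simpa using lp.norm_nonneg' f
  · exact lp.norm_apply_le_norm hp f b

theorem sum_norm_pullback_rpow_le_norm (hφ : PartialInjective φ) {p : ℝ≥0∞}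
    (hp : 0 < p.toReal) (f : lp (fun _ : β => ℂ) p) (s : Finset α) :
    ∑ a ∈ s, ‖pullback φ f a‖ ^ p.toReal ≤ ‖f‖ ^ p.toReal := by
  obtain ⟨t, ht⟩ := sum_norm_pullback_rpow_le hφ hp f s
  exact ht.trans (lp.sum_rpow_le_norm_rpow hp f t)

theorem memℓp_pullback (hφ : PartialInjective φ) (p : ℝ≥0∞) [h1 : Fact (1 ≤ p)]
    (f : lp (fun _ : β => ℂ) p) : Memℓp (pullback φ f) p := by
  rcases eq_or_ne p ∞ with rfl | hp
  · refine memℓp_infty ⟨‖f‖, ?_⟩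
    rintro _ ⟨u, rfl⟩
    exact norm_pullback_apply_le φ ENNReal.top_ne_zero f u
  · have := one_le_toReal h1.out hp
    exact memℓp_gen' (sum_norm_pullback_rpow_le_norm hφ (by linarith) f)

/-- The pullback along a partial injection, as a contraction between `ℓ^p` spaces. -/
def pullbackLp (hφ : PartialInjective φ) (p : ℝ≥0∞) [h1 : Fact (1 ≤ p)] :
    lp (fun _ : β => ℂ) p →L[ℂ] lp (fun _ : α => ℂ) p :=
  LinearMap.mkContinuous
    { toFun := fun f => ⟨pullback φ f, memℓp_pullback hφ p f⟩
      map_add' := fun f g => by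
        ext a
        change (φ a).elim 0 (f + g : lp (fun _ : β => ℂ) p) = (φ a).elim 0 f + (φ a).elim 0 g
        rcases φ a with _ | b
        · exact (add_zero (0 : ℂ)).symm
        · rfl
      map_smul' := fun c f => by
        ext a
        change (φ a).elim 0 (c • f : lp (fun _ : β => ℂ) p) = c * (φ a).elim 0 f
        rcases φ a with _ | b
        · exact (mul_zero c).symm
        · rfl }
    1 (fun f => by
      rw [one_mul]
      rcases eq_or_ne p ∞ with rfl | hp
      · exact lp.norm_le_of_forall_le (norm_nonneg _)
          (norm_pullback_apply_le φ ENNReal.top_ne_zero f)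
      · have := one_le_toReal h1.out hp
        exact lp.norm_le_of_forall_sum_le (by linarith) (norm_nonneg _)
          (sum_norm_pullback_rpow_le_norm hφ (by linarith) f))

theorem pullbackLp_apply (hφ : PartialInjective φ) (p : ℝ≥0∞) [Fact (1 ≤ p)]
    (f : lp (fun _ : β => ℂ) p) (a : α) : pullbackLp hφ p f a = (φ a).elim 0 f := rfl

theorem norm_pullbackLp_le (hφ : PartialInjective φ) (p : ℝ≥0∞) [Fact (1 ≤ p)] :
    ‖pullbackLp hφ p‖ ≤ 1 :=
  LinearMap.mkContinuous_norm_le _ zero_le_one _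

theorem norm_pullbackLp_apply_le (hφ : PartialInjective φ) (p : ℝ≥0∞) [Fact (1 ≤ p)]
    (f : lp (fun _ : β => ℂ) p) : ‖pullbackLp hφ p f‖ ≤ ‖f‖ := by
  simpa using (pullbackLp hφ p).le_of_opNorm_le (norm_pullbackLp_le hφ p) f

end Pullback

/-! ### Translations on `ℓ^p(ℕ)` -/

section Translations

variable (p : ℝ≥0∞) [Fact (1 ≤ p)]

theorem partialInjective_leftShift (N : ℕ) :
    PartialInjective fun k : ℕ => some (k + N) := by
  intro a a' b h h'
  simp only [Option.some.injEq] at h h'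
  omega

theorem partialInjective_rightShift (N : ℕ) :
    PartialInjective fun k : ℕ => if N ≤ k then some (k - N) else none := by
  intro a a' b h h'
  simp only [Option.ite_none_right_eq_some, Option.some.injEq] at h h'
  omega

/-- The left translation `(L_N f)(k) = f(k + N)`. -/
def leftShift (N : ℕ) : lp (fun _ : ℕ => ℂ) p →L[ℂ] lp (fun _ : ℕ => ℂ) p :=
  pullbackLp (partialInjective_leftShift N) p

/-- The right translation `(R_N f)(k) = f(k - N)`, which is zero for `k < N`. -/
def rightShift (N : ℕ) : lp (fun _ : ℕ => ℂ) p →L[ℂ] lp (fun _ : ℕ => ℂ) p :=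
  pullbackLp (partialInjective_rightShift N) p

variable {p}

theorem leftShift_apply (N : ℕ) (f : lp (fun _ : ℕ => ℂ) p) (k : ℕ) :
    leftShift p N f k = f (k + N) := rfl

theorem rightShift_apply (N : ℕ) (f : lp (fun _ : ℕ => ℂ) p) (k : ℕ) :
    rightShift p N f k = if N ≤ k then f (k - N) else 0 := by
  rw [rightShift, pullbackLp_apply]
  split_ifs <;> rfl

theorem norm_leftShift_le (N : ℕ) : ‖leftShift p N‖ ≤ 1 := norm_pullbackLp_le _ p

theorem norm_rightShift_le (N : ℕ) : ‖rightShift p N‖ ≤ 1 := norm_pullbackLp_le _ p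

theorem leftShift_rightShift (N : ℕ) (f : lp (fun _ : ℕ => ℂ) p) :
    leftShift p N (rightShift p N f) = f := by
  ext k
  rw [leftShift_apply, rightShift_apply, if_pos (by omega), Nat.add_sub_cancel]

/-- A contraction with a contractive left inverse is isometric. -/
theorem norm_rightShift_apply (N : ℕ) (f : lp (fun _ : ℕ => ℂ) p) :
    ‖rightShift p N f‖ = ‖f‖ := by
  refine le_antisymm (norm_pullbackLp_apply_le _ p f) ?_
  conv_lhs => rw [← leftShift_rightShift N f]
  exact norm_pullbackLp_apply_le _ p _

theorem rightShift_comm (M N : ℕ) (f : lp (fun _ : ℕ => ℂ) p) :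
    rightShift p M (rightShift p N f) = rightShift p N (rightShift p M f) := by
  ext k
  simp only [rightShift_apply]
  rw [Nat.sub_right_comm]
  split_ifs <;> first | rfl | omega

end Translations

/-! ### The shift of the tail -/

section Tail

theorem tail_neighborFinset_zero : tail.neighborFinset 0 = {1} := by
  ext k
  rw [SimpleGraph.mem_neighborFinset, Finset.mem_singleton]
  change 0 + 1 = k ∨ k + 1 = 0 ↔ _
  omega

theorem tail_neighborFinset_succ (k : ℕ) : tail.neighborFinset (k + 1) = {k, k + 2} := by
  ext j
  rw [SimpleGraph.mem_neighborFinset, Finset.mem_insert, Finset.mem_singleton]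
  change k + 1 + 1 = j ∨ j + 1 = k + 1 ↔ _
  omega

variable (p : ℝ≥0∞) [Fact (1 ≤ p)]

theorem tailShift_eq : tailShift p = leftShift p 1 + rightShift p 1 := by
  ext f k
  rw [tailShift, shiftLp_apply, add_apply]
  change _ = leftShift p 1 f k + rightShift p 1 f k
  rw [leftShift_apply, rightShift_apply]
  rcases k with _ | k
  · simp [tail_neighborFinset_zero]
  · rw [tail_neighborFinset_succ, Finset.sum_pair (by omega), if_pos (by omega),
      Nat.add_sub_cancel]
    exact add_comm _ _

/-- The factorization `T - (b + 1/b) = -b⁻¹ (1 - b L) (1 - b R)`. -/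
theorem tailShift_sub_eq {b : ℂ} (hb : b ≠ 0) :
    tailShift p - (b + b⁻¹) • ContinuousLinearMap.id ℂ _ =
      (-b⁻¹) • ((1 - b • leftShift p 1) * (1 - b • rightShift p 1)) := by
  -- Only `LR = 1` holds, since `RL` erases the value at `0`; hence the order of the two factors
  -- matters.
  have h : leftShift p 1 * rightShift p 1 = 1 := by
    refine ContinuousLinearMap.ext fun f => ?_
    exact leftShift_rightShift 1 f
  have h1 : ContinuousLinearMap.id ℂ (lp (fun _ : ℕ => ℂ) p) = 1 := rfl
  rw [tailShift_eq, h1, mul_sub, mul_one, sub_mul, one_mul, smul_mul_smul_comm, h]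
  simp only [smul_sub, smul_smul, neg_mul, inv_mul_cancel₀ hb, inv_mul_cancel_left₀ hb]
  module

end Tail

/-! ### The band `[-2, 2]` -/

section Band

/-- The two roots of `b² - z b + 1` have product `1`, so one of them lies in the closed unit disc.
-/
theorem exists_eq_add_inv (z : ℂ) : ∃ b : ℂ, b ≠ 0 ∧ ‖b‖ ≤ 1 ∧ z = b + b⁻¹ := by
  obtain ⟨s, hs⟩ := IsAlgClosed.exists_pow_nat_eq (z ^ 2 - 4) (n := 2) two_pos
  have key : ((z + s) / 2) * ((z - s) / 2) = 1 := by linear_combination (-1 / 4 : ℂ) * hs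
  have h1 : (z + s) / 2 ≠ 0 := left_ne_zero_of_mul_eq_one key
  have h2 : (z - s) / 2 ≠ 0 := right_ne_zero_of_mul_eq_one key
  rcases le_total ‖(z + s) / 2‖ 1 with h | h
  · refine ⟨(z + s) / 2, h1, h, ?_⟩
    rw [← eq_inv_of_mul_eq_one_right key]
    ring
  · refine ⟨(z - s) / 2, h2, ?_, ?_⟩
    · rw [eq_inv_of_mul_eq_one_right key, norm_inv]
      exact inv_le_one_of_one_le₀ h
    · rw [← eq_inv_of_mul_eq_one_left key]
      ring

theorem add_inv_mem_band {b : ℂ} (hb : ‖b‖ = 1) : b + b⁻¹ ∈ band := by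
  have h1 : b⁻¹ = (starRingEnd ℂ) b := Complex.inv_eq_conj hb
  refine ⟨2 * b.re, ?_, ?_⟩
  · have := Complex.abs_re_le_norm b
    rw [hb, abs_le] at this
    constructor <;> linarith
  · rw [h1, Complex.add_conj]

theorem exists_norm_eq_one_of_mem_band {z : ℂ} (hz : z ∈ band) :
    ∃ b : ℂ, ‖b‖ = 1 ∧ z = b + b⁻¹ := by
  obtain ⟨x, ⟨hx1, hx2⟩, rfl⟩ := hz
  have hn : Real.cos (Real.arccos (x / 2)) = x / 2 :=
    Real.cos_arccos (by linarith) (by linarith)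
  refine ⟨Complex.exp (Real.arccos (x / 2) * Complex.I), Complex.norm_exp_ofReal_mul_I _, ?_⟩
  rw [← Complex.exp_neg, ← neg_mul, ← Complex.two_cos, ← Complex.ofReal_cos, hn]
  push_cast
  ring

theorem exists_norm_lt_one_of_notMem_band {z : ℂ} (hz : z ∉ band) :
    ∃ b : ℂ, b ≠ 0 ∧ ‖b‖ < 1 ∧ z = b + b⁻¹ := by
  obtain ⟨b, hb0, hb1, rfl⟩ := exists_eq_add_inv z
  exact ⟨b, hb0, lt_of_le_of_ne hb1 fun h => hz (add_inv_mem_band h), rfl⟩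

end Band

/-! ### The spectrum of the tail -/

section TailSpectrum

theorem memℓp_of_eventually_zero (p : ℝ≥0∞) {f : ℕ → ℂ} (N : ℕ) (hf : ∀ k, N ≤ k → f k = 0) :
    Memℓp f p := by
  have h0 : Memℓp f 0 := memℓp_zero ((Set.finite_lt_nat N).subset fun k hk => by
    by_contra h
    exact hk (hf k (not_lt.1 h)))
  exact h0.of_exponent_ge zero_le

variable (p : ℝ≥0∞)

/-- The indicator function of `{0, …, N - 1}` in `ℓ^p`. -/
def blockIndicator (N : ℕ) : lp (fun _ : ℕ => ℂ) p :=
  ⟨fun k => if k < N then 1 else 0,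
    memℓp_of_eventually_zero p N fun k hk => if_neg (by omega)⟩

/-- The tent of width `4 q`, modulated by the character `k ↦ b ^ k`. -/
def modulatedTent (b : ℂ) (q : ℕ) : lp (fun _ : ℕ => ℂ) p :=
  ⟨fun k => b ^ k * (min k (4 * q - k) : ℕ),
    memℓp_of_eventually_zero p (4 * q) fun k hk => by
      have : min k (4 * q - k) = 0 := by omega
      rw [this, Nat.cast_zero, mul_zero]⟩

variable {p}

theorem blockIndicator_apply (N k : ℕ) : blockIndicator p N k = if k < N then 1 else 0 := rfl

theorem modulatedTent_apply (b : ℂ) (q k : ℕ) :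
    modulatedTent p b q k = b ^ k * (min k (4 * q - k) : ℕ) := rfl

theorem modulatedTent_apply_eq_zero (b : ℂ) {q k : ℕ} (hk : 4 * q ≤ k) :
    modulatedTent p b q k = 0 := by
  have : min k (4 * q - k) = 0 := by omega
  rw [modulatedTent_apply, this, Nat.cast_zero, mul_zero]

variable [Fact (1 ≤ p)]

theorem ne_zero_of_fact_one_le : p ≠ 0 :=
  (zero_lt_one.trans_le (Fact.out : 1 ≤ p)).ne'

theorem one_le_norm_blockIndicator {N : ℕ} (hN : 0 < N) : 1 ≤ ‖blockIndicator p N‖ := by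
  have h := lp.norm_apply_le_norm ne_zero_of_fact_one_le (blockIndicator p N) 0
  rwa [blockIndicator_apply, if_pos hN, norm_one] at h

/-- On its middle half `[q, 3q)` the tent has height at least `q`. Comparing with the norm of a
block avoids computing norms and treats all `p` alike. -/
theorem mul_norm_blockIndicator_le {b : ℂ} (hb : ‖b‖ = 1) (q : ℕ) :
    q * ‖blockIndicator p (2 * q)‖ ≤ ‖modulatedTent p b q‖ := by
  have h : ‖(q : ℂ) • rightShift p q (blockIndicator p (2 * q))‖ ≤ ‖modulatedTent p b q‖ := by
    refine lp.norm_mono ne_zero_of_fact_one_le fun k => ?_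
    change ‖(q : ℂ) * rightShift p q (blockIndicator p (2 * q)) k‖ ≤ _
    rw [rightShift_apply, modulatedTent_apply, norm_mul, norm_mul, norm_pow, hb, one_pow, one_mul,
      Complex.norm_natCast, Complex.norm_natCast, blockIndicator_apply]
    split_ifs with h1 h2
    · rw [norm_one, mul_one]
      have : q ≤ min k (4 * q - k) := by omega
      exact_mod_cast this
    · simp
    · simp
  rwa [norm_smul, Complex.norm_natCast, norm_rightShift_apply] at h

/-- The modulation cancels, leaving the increments of the tent: they have modulus one on `[1, 2q]`
and on `[2q + 1, 4q]`, two translates of the block, and vanish elsewhere. -/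
theorem norm_sub_smul_rightShift_modulatedTent_le {b : ℂ} (hb : ‖b‖ = 1) (q : ℕ) :
    ‖modulatedTent p b q - b • rightShift p 1 (modulatedTent p b q)‖ ≤
      2 * ‖blockIndicator p (2 * q)‖ := by
  set u := blockIndicator p (2 * q) with hu
  have h : ‖modulatedTent p b q - b • rightShift p 1 (modulatedTent p b q)‖ ≤
      ‖rightShift p 1 u + rightShift p (2 * q + 1) u‖ := by
    refine lp.norm_mono ne_zero_of_fact_one_le fun k => ?_
    change ‖modulatedTent p b q k - b * rightShift p 1 (modulatedTent p b q) k‖ ≤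
      ‖rightShift p 1 u k + rightShift p (2 * q + 1) u k‖
    simp only [rightShift_apply, modulatedTent_apply, hu, blockIndicator_apply]
    rcases k with _ | k
    · simp
    · rw [if_pos (by omega : 1 ≤ k + 1), if_pos (by omega : 1 ≤ k + 1), Nat.add_sub_cancel]
      rcases lt_or_ge k (2 * q) with h1 | h1
      · have e1 : min (k + 1) (4 * q - (k + 1)) = k + 1 := by omega
        have e2 : min k (4 * q - k) = k := by omega
        rw [e1, e2, if_pos h1, if_neg (by omega)]
        have e : b ^ (k + 1) * ((k + 1 : ℕ) : ℂ) - b * (b ^ k * (k : ℂ)) = b ^ (k + 1) := by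
          push_cast
          ring
        rw [e, norm_pow, hb, one_pow, add_zero, norm_one]
      · rw [if_neg (by omega), if_pos (by omega : 2 * q + 1 ≤ k + 1), zero_add]
        rcases lt_or_ge k (4 * q) with h2 | h2
        · have e1 : min (k + 1) (4 * q - (k + 1)) = 4 * q - (k + 1) := by omega
          have e2 : min k (4 * q - k) = 4 * q - (k + 1) + 1 := by omega
          rw [e1, e2, if_pos (by omega)]
          generalize 4 * q - (k + 1) = m
          have e : b ^ (k + 1) * (m : ℂ) - b * (b ^ k * ((m + 1 : ℕ) : ℂ)) = -b ^ (k + 1) := by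
            push_cast
            ring
          rw [e, norm_neg, norm_pow, hb, one_pow, norm_one]
        · have e1 : min (k + 1) (4 * q - (k + 1)) = 0 := by omega
          have e2 : min k (4 * q - k) = 0 := by omega
          rw [e1, e2]
          simp
  refine h.trans ((norm_add_le _ _).trans ?_)
  rw [norm_rightShift_apply, norm_rightShift_apply]
  linarith

/-- The two translates have disjoint supports. Translating back by `4 q i` leaves the tent on `[0,
4q)`, where the other translate is zero. -/
theorem norm_modulatedTent_le_norm_sub (b : ℂ) (q : ℕ) {i j : ℕ} (hij : i < j) :
    ‖modulatedTent p b q‖ ≤ ‖rightShift p (4 * q * i) (modulatedTent p b q) -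
      rightShift p (4 * q * j) (modulatedTent p b q)‖ := by
  set f := modulatedTent p b q with hf
  have h1 : ‖f‖ ≤ ‖leftShift p (4 * q * i) (rightShift p (4 * q * i) f -
      rightShift p (4 * q * j) f)‖ := by
    refine lp.norm_mono ne_zero_of_fact_one_le fun k => ?_
    rw [leftShift_apply]
    change _ ≤ ‖rightShift p (4 * q * i) f (k + 4 * q * i) -
      rightShift p (4 * q * j) f (k + 4 * q * i)‖
    rcases le_or_gt (4 * q) k with hk | hk
    · rw [hf, modulatedTent_apply_eq_zero b hk, norm_zero]
      exact norm_nonneg _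
    · have h2 : 4 * q * (i + 1) ≤ 4 * q * j := Nat.mul_le_mul_left _ hij
      rw [mul_add, mul_one] at h2
      rw [rightShift_apply, rightShift_apply, if_pos (by omega), if_neg (by omega), sub_zero,
        Nat.add_sub_cancel]
  exact h1.trans (norm_pullbackLp_apply_le _ p _)

theorem not_isFredholm_tailShift_sub {b : ℂ} (hb : ‖b‖ = 1) :
    ¬ (tailShift p - (b + b⁻¹) • ContinuousLinearMap.id ℂ _).IsFredholm := by
  intro hF
  have hb0 : b ≠ 0 := by
    rintro rfl
    simp at hb
  obtain ⟨K, hK0, hK⟩ := exists_separation_le_of_isFredholm hF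
  -- The separation is at least `q ‖u‖` and the images have norm at most `4 ‖u‖`, so a Fredholm
  -- operator would force `q ≤ 4 K`.
  obtain ⟨n, hn⟩ := exists_nat_gt (K * 4)
  set q := n + 1 with hq
  set f := modulatedTent p b q with hf
  set u := blockIndicator p (2 * q) with hu
  have hu1 : 1 ≤ ‖u‖ := one_le_norm_blockIndicator (by omega)
  have hA : ∀ i, ‖(tailShift p - (b + b⁻¹) • ContinuousLinearMap.id ℂ (lp (fun _ : ℕ => ℂ) p))
      (rightShift p (4 * q * i) f)‖ ≤ 4 * ‖u‖ := by
    intro i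
    -- The factor that acts first commutes with right translations, so the bound for one tent serves
    -- all translates; the factor `1 - bL` then costs at most a further `2`.
    have e : (1 - b • rightShift p 1) (rightShift p (4 * q * i) f) =
        rightShift p (4 * q * i) (f - b • rightShift p 1 f) := by
      rw [map_sub, map_smul, ← rightShift_comm]
      rfl
    rw [tailShift_sub_eq p hb0]
    change ‖(-b⁻¹) • (1 - b • leftShift p 1) ((1 - b • rightShift p 1)
      (rightShift p (4 * q * i) f))‖ ≤ _
    rw [e, norm_smul, norm_neg, norm_inv, hb, inv_one, one_mul]
    set g := rightShift p (4 * q * i) (f - b • rightShift p 1 f) with hg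
    have hgn : ‖g‖ ≤ 2 * ‖u‖ := by
      rw [hg, norm_rightShift_apply]
      exact norm_sub_smul_rightShift_modulatedTent_le hb q
    change ‖g - b • leftShift p 1 g‖ ≤ _
    calc ‖g - b • leftShift p 1 g‖ ≤ ‖g‖ + ‖b • leftShift p 1 g‖ := norm_sub_le _ _
      _ ≤ ‖g‖ + ‖g‖ := by
          rw [norm_smul, hb, one_mul]
          exact add_le_add le_rfl (norm_pullbackLp_apply_le _ p g)
      _ ≤ 4 * ‖u‖ := by linarith
  have h := hK (fun i => rightShift p (4 * q * i) f) ‖f‖ ‖f‖ (4 * ‖u‖)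
    (fun i => (norm_rightShift_apply _ f).le)
    (fun i j hij => norm_modulatedTent_le_norm_sub b q hij) hA
  have h2 : (q : ℝ) * ‖u‖ ≤ K * 4 * ‖u‖ := by
    calc (q : ℝ) * ‖u‖ ≤ ‖f‖ := mul_norm_blockIndicator_le hb q
      _ ≤ _ := by linarith
  have h3 : (q : ℝ) ≤ K * 4 := le_of_mul_le_mul_right h2 (by linarith)
  rw [hq] at h3
  push_cast at h3
  linarith

theorem isUnit_tailShift_sub {b : ℂ} (hb0 : b ≠ 0) (hb : ‖b‖ < 1) :
    IsUnit (tailShift p - (b + b⁻¹) • ContinuousLinearMap.id ℂ _) := by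
  rw [tailShift_sub_eq p hb0]
  have key : ∀ A : lp (fun _ : ℕ => ℂ) p →L[ℂ] lp (fun _ : ℕ => ℂ) p, ‖A‖ ≤ 1 →
      IsUnit (1 - b • A) := by
    intro A hA
    refine isUnit_one_sub_of_norm_lt_one (lt_of_le_of_lt (norm_smul_le b A) ?_)
    nlinarith [norm_nonneg b]
  have h := (key _ (norm_leftShift_le 1)).mul (key _ (norm_rightShift_le (p := p) 1))
  have h2 : -b⁻¹ ≠ 0 := neg_ne_zero.2 (inv_ne_zero hb0)
  rw [Algebra.smul_def]
  exact ((isUnit_iff_ne_zero.2 h2).map _).mul h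

theorem band_subset_essentialSpectrum_tailShift : band ⊆ essentialSpectrum (tailShift p) := by
  intro z hz
  obtain ⟨b, hb, rfl⟩ := exists_norm_eq_one_of_mem_band hz
  exact not_isFredholm_tailShift_sub hb

theorem spectrum_tailShift_subset_band : spectrum ℂ (tailShift p) ⊆ band := by
  intro z hz
  by_contra h
  obtain ⟨b, hb0, hb, rfl⟩ := exists_norm_lt_one_of_notMem_band h
  exact notMem_spectrum_of_isUnit_sub (isUnit_tailShift_sub hb0 hb) hz

variable (p)

theorem essentialSpectrum_tailShift : essentialSpectrum (tailShift p) = band :=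
  ((essentialSpectrum_subset_spectrum _).trans spectrum_tailShift_subset_band).antisymm
    band_subset_essentialSpectrum_tailShift

theorem spectrum_tailShift : spectrum ℂ (tailShift p) = band :=
  spectrum_tailShift_subset_band.antisymm
    (band_subset_essentialSpectrum_tailShift.trans (essentialSpectrum_subset_spectrum _))

end TailSpectrum

/-! ### A finite graph with a tail: reduction to the tail -/

section AttachTail

universe v

variable {V : Type v}

/-- The range embeds into the functions on the finite set `s`. -/
theorem hasFiniteRange_of_support {E : Type*} [AddCommGroup E] [Module ℂ E] {X : Type*}
    {p : ℝ≥0∞} (D : E →ₗ[ℂ] lp (fun _ : X => ℂ) p) {s : Set X} (hs : s.Finite)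
    (hD : ∀ f, ∀ x ∉ s, D f x = 0) : D.HasFiniteRange := by
  have := hs.to_subtype
  let ρ : D.range →ₗ[ℂ] (s → ℂ) :=
    { toFun := fun g x => (g : lp (fun _ : X => ℂ) p) x
      map_add' := fun _ _ => rfl
      map_smul' := fun _ _ => rfl }
  have hρ : Function.Injective ρ := by
    rw [injective_iff_map_eq_zero]
    rintro ⟨_, f, rfl⟩ hf
    refine Subtype.ext (lp.ext (funext fun x => ?_))
    by_cases hx : x ∈ s
    · exact congrFun hf ⟨x, hx⟩
    · exact hD f x hx
  have := Module.Finite.of_injective ρ hρ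
  exact Module.Finite.iff_fg.1 this

theorem partialInjective_restrictTail :
    PartialInjective fun k : ℕ => some (Sum.inr k : V ⊕ ℕ) := by
  intro a a' b h h'
  simpa using h.trans h'.symm

theorem partialInjective_extendTail :
    PartialInjective (Sum.elim (fun _ : V => none) some : V ⊕ ℕ → Option ℕ) := by
  rintro (a | k) (a' | k') b h h' <;> simp_all

variable (V) in
/-- The restriction of a function on `V ⊕ ℕ` to the tail. -/
def restrictTail (p : ℝ≥0∞) [Fact (1 ≤ p)] :
    lp (fun _ : V ⊕ ℕ => ℂ) p →L[ℂ] lp (fun _ : ℕ => ℂ) p :=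
  pullbackLp partialInjective_restrictTail p

variable (V) in
/-- The extension by zero of a function on the tail to `V ⊕ ℕ`. -/
def extendTail (p : ℝ≥0∞) [Fact (1 ≤ p)] :
    lp (fun _ : ℕ => ℂ) p →L[ℂ] lp (fun _ : V ⊕ ℕ => ℂ) p :=
  pullbackLp partialInjective_extendTail p

theorem restrictTail_comp_extendTail (p : ℝ≥0∞) [Fact (1 ≤ p)] :
    restrictTail V p ∘L extendTail V p = ContinuousLinearMap.id ℂ _ := by
  ext f k
  rfl

/-- With `J` the extension and `P` the restriction, `PJ = 1` makes `A ↦ JAP + (1 - JP)`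
multiplicative and unital. The term `1 - JP` acts as the identity on functions on `V`, which `JAP`
alone would kill. -/
theorem isUnit_extend_restrict (p : ℝ≥0∞) [Fact (1 ≤ p)]
    {A : lp (fun _ : ℕ => ℂ) p →L[ℂ] lp (fun _ : ℕ => ℂ) p}
    (hA : IsUnit A) : IsUnit (extendTail V p ∘L A ∘L restrictTail V p +
      (ContinuousLinearMap.id ℂ _ - extendTail V p ∘L restrictTail V p)) := by
  obtain ⟨u, rfl⟩ := hA
  have key : ∀ A B : lp (fun _ : ℕ => ℂ) p →L[ℂ] lp (fun _ : ℕ => ℂ) p, A * B = 1 →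
      (extendTail V p ∘L A ∘L restrictTail V p +
        (ContinuousLinearMap.id ℂ _ - extendTail V p ∘L restrictTail V p)) *
      (extendTail V p ∘L B ∘L restrictTail V p +
        (ContinuousLinearMap.id ℂ _ - extendTail V p ∘L restrictTail V p)) = 1 := by
    intro A B hAB
    have e1 : ∀ y, restrictTail V p (extendTail V p y) = y :=
      fun y => DFunLike.congr_fun (restrictTail_comp_extendTail (V := V) p) y
    have e2 : ∀ y, A (B y) = y := fun y => DFunLike.congr_fun hAB y
    refine ContinuousLinearMap.ext fun f => ?_
    simp [e1, e2]
  exact ⟨⟨_, _, key _ _ u.mul_inv, key _ _ u.inv_mul⟩, rfl⟩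

variable [Fintype V] (H : SimpleGraph V) (v₀ : V)

theorem shift_attachTail_inr_zero (f : V ⊕ ℕ → ℂ) :
    shift (attachTail H v₀) f (Sum.inr 0) = f (Sum.inl v₀) + f (Sum.inr 1) := by
  classical
  have h : (attachTail H v₀).neighborFinset (Sum.inr 0) = {Sum.inl v₀, Sum.inr 1} := by
    ext y
    rw [SimpleGraph.mem_neighborFinset, Finset.mem_insert, Finset.mem_singleton]
    rcases y with a | k
    · change a = v₀ ∧ (0 : ℕ) = 0 ↔ _
      simp
    · change 0 + 1 = k ∨ k + 1 = 0 ↔ _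
      simp
      omega
  rw [shift, h, Finset.sum_pair (by simp)]

theorem shift_attachTail_inr_succ (f : V ⊕ ℕ → ℂ) (k : ℕ) :
    shift (attachTail H v₀) f (Sum.inr (k + 1)) = f (Sum.inr k) + f (Sum.inr (k + 2)) := by
  classical
  have h : (attachTail H v₀).neighborFinset (Sum.inr (k + 1)) =
      {Sum.inr k, Sum.inr (k + 2)} := by
    ext y
    rw [SimpleGraph.mem_neighborFinset, Finset.mem_insert, Finset.mem_singleton]
    rcases y with a | j
    · change a = v₀ ∧ k + 1 = 0 ↔ _
      simp
    · change k + 1 + 1 = j ∨ j + 1 = k + 1 ↔ _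
      simp
      omega
  rw [shift, h, Finset.sum_pair (by simp)]

theorem shift_attachTail_inl_of_ne [H.LocallyFinite] (f : V ⊕ ℕ → ℂ) {a : V} (ha : a ≠ v₀) :
    shift (attachTail H v₀) f (Sum.inl a) = shift H (fun v => f (Sum.inl v)) a := by
  classical
  have h : (attachTail H v₀).neighborFinset (Sum.inl a) =
      (H.neighborFinset a).map Function.Embedding.inl := by
    ext y
    rw [SimpleGraph.mem_neighborFinset]
    rcases y with b | k
    · change H.Adj a b ↔ _
      simp
    · change a = v₀ ∧ k = 0 ↔ _
      simp [ha]
  rw [shift, h, Finset.sum_map]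
  rfl

theorem shift_attachTail_inl_self [H.LocallyFinite] (f : V ⊕ ℕ → ℂ) :
    shift (attachTail H v₀) f (Sum.inl v₀) =
      shift H (fun v => f (Sum.inl v)) v₀ + f (Sum.inr 0) := by
  classical
  have h : (attachTail H v₀).neighborFinset (Sum.inl v₀) =
      insert (Sum.inr 0) ((H.neighborFinset v₀).map Function.Embedding.inl) := by
    ext y
    rw [SimpleGraph.mem_neighborFinset]
    rcases y with b | k
    · change H.Adj v₀ b ↔ _
      simp
    · change v₀ = v₀ ∧ k = 0 ↔ _
      simp
  rw [shift, h, Finset.sum_insert (by simp), Finset.sum_map, add_comm]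
  rfl

variable (p : ℝ≥0∞) [Fact (1 ≤ p)]

theorem hasFiniteRange_id_sub_extend_restrict :
    ((ContinuousLinearMap.id ℂ _ - extendTail V p ∘L restrictTail V p :
      lp (fun _ : V ⊕ ℕ => ℂ) p →L[ℂ] lp (fun _ : V ⊕ ℕ => ℂ) p) :
      lp (fun _ : V ⊕ ℕ => ℂ) p →ₗ[ℂ] lp (fun _ : V ⊕ ℕ => ℂ) p).HasFiniteRange := by
  refine hasFiniteRange_of_support _ (Set.finite_range (Sum.inl : V → V ⊕ ℕ)) fun f x hx => ?_
  rcases x with a | k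
  · simp at hx
  · exact sub_self (f (Sum.inr k))

/-- The two operators can produce different values only on `H` and at `u_1`, the one tail vertex
that sees `v₀`. -/
theorem hasFiniteRange_attachTailShift_sub (z : ℂ) :
    ((attachTailShift H v₀ p - z • ContinuousLinearMap.id ℂ _ -
      extendTail V p ∘L (tailShift p - z • ContinuousLinearMap.id ℂ _) ∘L restrictTail V p :
      lp (fun _ : V ⊕ ℕ => ℂ) p →L[ℂ] lp (fun _ : V ⊕ ℕ => ℂ) p) :
      lp (fun _ : V ⊕ ℕ => ℂ) p →ₗ[ℂ] lp (fun _ : V ⊕ ℕ => ℂ) p).HasFiniteRange := by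
  refine hasFiniteRange_of_support _
    ((Set.finite_range (Sum.inl : V → V ⊕ ℕ)).union (Set.finite_singleton (Sum.inr 0)))
    fun f x hx => ?_
  rcases x with a | k
  · simp at hx
  · rcases k with _ | k
    · simp at hx
    · change (shift (attachTail H v₀) f (Sum.inr (k + 1)) - z * f (Sum.inr (k + 1))) -
        (shift tail (restrictTail V p f) (k + 1) - z * f (Sum.inr (k + 1))) = 0
      have h2 : shift tail (restrictTail V p f) (k + 1) = f (Sum.inr k) + f (Sum.inr (k + 2)) := by
        rw [shift, tail_neighborFinset_succ, Finset.sum_pair (by omega)]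
        rfl
      rw [shift_attachTail_inr_succ H, h2, sub_self]

theorem essentialSpectrum_attachTailShift : essentialSpectrum (attachTailShift H v₀ p) = band := by
  rw [← essentialSpectrum_tailShift p]
  ext z
  exact not_congr (isFredholm_iff_of_quasiInverse (restrictTail_comp_extendTail p)
    (hasFiniteRange_id_sub_extend_restrict p) (hasFiniteRange_attachTailShift_sub H v₀ p z))

/-- Off the band, `T - z` is invertible, hence so is its extension by the identity on `H`, from
which `S - z` differs by finite rank; injectivity is then enough. -/
theorem spectrum_attachTailShift_eq_union_pointSpectrum :
    spectrum ℂ (attachTailShift H v₀ p) = band ∪ pointSpectrum (attachTailShift H v₀ p) := by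
  refine Set.Subset.antisymm (fun z hz => ?_) (Set.union_subset ?_ ?_)
  · by_contra h
    rw [Set.mem_union, not_or] at h
    refine notMem_spectrum_of_isUnit_sub ?_ hz
    have hT : z ∉ spectrum ℂ (tailShift p) := by
      rw [spectrum_tailShift]
      exact h.1
    refine isUnit_of_injective_of_hasFiniteRange_sub
      (isUnit_extend_restrict (V := V) p (isUnit_sub_of_notMem_spectrum hT)) ?_ fun x hx => ?_
    · have h1 := (hasFiniteRange_attachTailShift_sub H v₀ p z).sub
        (hasFiniteRange_id_sub_extend_restrict (V := V) p)
      rw [← sub_sub]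
      exact h1
    · by_contra hx0
      refine h.2 (mem_pointSpectrum_iff.2 ⟨x, hx0, ?_⟩)
      exact sub_eq_zero.1 hx
  · rw [← essentialSpectrum_attachTailShift H v₀ p]
    exact essentialSpectrum_subset_spectrum _
  · exact pointSpectrum_subset_spectrum _

end AttachTail

/-! ### The eigenvalue recursion on the tail -/

section Recursion

/-- For solutions of `a_{k+1} + a_{k-1} = (b + 1/b) a_k`, the sequence `a_{k+1} - b a_k` is
geometric. -/
theorem recursion_sub_mul_eq {a : ℕ → ℂ} {b : ℂ} (hb : b ≠ 0) {n : ℕ}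
    (ha : ∀ k, k < n → a k + a (k + 2) = (b + b⁻¹) * a (k + 1)) :
    ∀ k, k ≤ n → b ^ k * (a (k + 1) - b * a k) = a 1 - b * a 0 := by
  intro k
  induction k with
  | zero => intro _; ring
  | succ k ih =>
    intro hk
    rw [← ih (by omega)]
    have h := ha k (by omega)
    have h1 : a (k + 2) = (b + b⁻¹) * a (k + 1) - a k := by rw [← h]; ring
    rw [h1]
    field_simp
    ring

/-- The invariant `a 1 - b a 0` equals `b ^ k` times a bounded quantity for every `k`, so it is
zero: the growing component `b ^ (-k)` is absent. -/
theorem eq_pow_mul_of_recursion_of_bounded {a : ℕ → ℂ} {b : ℂ} (hb : b ≠ 0) (hb1 : ‖b‖ < 1)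
    (ha : ∀ k, a k + a (k + 2) = (b + b⁻¹) * a (k + 1)) {C : ℝ} (hC : ∀ k, ‖a k‖ ≤ C) (k : ℕ) :
    a k = b ^ k * a 0 := by
  have h := fun k => recursion_sub_mul_eq (n := k) hb (fun j _ => ha j) k le_rfl
  have h0 : a 1 - b * a 0 = 0 := by
    have hlim : Filter.Tendsto (fun k => ‖b‖ ^ k * (2 * C)) Filter.atTop (nhds 0) := by
      simpa using (tendsto_pow_atTop_nhds_zero_of_lt_one (norm_nonneg b) hb1).mul_const (2 * C)
    rw [← norm_le_zero_iff]
    refine ge_of_tendsto' hlim fun k => ?_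
    rw [← h k, norm_mul, norm_pow]
    refine mul_le_mul_of_nonneg_left ?_ (by positivity)
    calc ‖a (k + 1) - b * a k‖ ≤ ‖a (k + 1)‖ + ‖b‖ * ‖a k‖ := by
          rw [← norm_mul]; exact norm_sub_le _ _
      _ ≤ 2 * C := by nlinarith [hC k, hC (k + 1), norm_nonneg (a k), norm_nonneg b]
  induction k with
  | zero => simp
  | succ k ih =>
    have h1 := h k
    rw [h0, mul_eq_zero, or_iff_right (pow_ne_zero k hb), sub_eq_zero, ih] at h1
    rw [h1, pow_succ']
    ring

/-- Both `|a_{k+1} - b a_k|` and then `|a_k|` are constant in `k` and tend to zero. The double roots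
`b = ±1` need no separate treatment. -/
theorem eq_zero_of_recursion_of_tendsto {a : ℕ → ℂ} {b : ℂ} (hb1 : ‖b‖ = 1)
    (ha : ∀ k, a k + a (k + 2) = (b + b⁻¹) * a (k + 1))
    (hlim : Filter.Tendsto a Filter.atTop (nhds 0)) (k : ℕ) : a k = 0 := by
  have hb : b ≠ 0 := by
    rintro rfl
    simp at hb1
  have h := fun k => recursion_sub_mul_eq (n := k) hb (fun j _ => ha j) k le_rfl
  have hlim1 : Filter.Tendsto (fun k => a (k + 1)) Filter.atTop (nhds 0) :=
    hlim.comp (Filter.tendsto_add_atTop_nat 1)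
  have h0 : a 1 - b * a 0 = 0 := by
    have hl : Filter.Tendsto (fun k => ‖a (k + 1) - b * a k‖) Filter.atTop (nhds 0) := by
      simpa using (hlim1.sub (hlim.const_mul b)).norm
    rw [← norm_le_zero_iff]
    refine ge_of_tendsto' hl fun k => ?_
    rw [← h k, norm_mul, norm_pow, hb1, one_pow, one_mul]
  have hk : ∀ k, a k = b ^ k * a 0 := by
    intro k
    induction k with
    | zero => simp
    | succ k ih =>
      have h1 := h k
      rw [h0, mul_eq_zero, or_iff_right (pow_ne_zero k hb), sub_eq_zero, ih] at h1
      rw [h1, pow_succ']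
      ring
  have ha0 : a 0 = 0 := by
    rw [← norm_le_zero_iff]
    refine ge_of_tendsto' (by simpa using hlim.norm) fun k => ?_
    rw [hk k, norm_mul, norm_pow, hb1, one_pow, one_mul]
  rw [hk k, ha0, mul_zero]

end Recursion

/-! ### Eigenvalues of a finite graph with a tail -/

section Eigenvalues

theorem tendsto_tail_zero {V : Type*} (p : ℝ≥0∞) [Fact (1 ≤ p)] (hp : p ≠ ∞)
    (x : lp (fun _ : V ⊕ ℕ => ℂ) p) :
    Filter.Tendsto (fun k : ℕ => x (Sum.inr k)) Filter.atTop (nhds 0) := by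
  have hr : 0 < p.toReal := zero_lt_one.trans_le (one_le_toReal Fact.out hp)
  have h1 := ((lp.memℓp x).summable hr).comp_injective (Sum.inr_injective (α := V) (β := ℕ))
  have h2 := h1.tendsto_atTop_zero
  have h3 := h2.rpow_const (p := 1 / p.toReal) (Or.inr (by positivity))
  rw [Real.zero_rpow (by positivity)] at h3
  rw [tendsto_zero_iff_norm_tendsto_zero]
  refine h3.congr fun k => ?_
  change (‖x (Sum.inr k)‖ ^ p.toReal) ^ (1 / p.toReal) = _
  rw [← Real.rpow_mul (norm_nonneg _), mul_one_div_cancel hr.ne', Real.rpow_one]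

theorem shift_eq_sum_ite {V : Type*} [Fintype V] (H : SimpleGraph V) [H.LocallyFinite]
    [DecidableRel H.Adj] (f : V → ℂ) (v : V) :
    shift H f v = ∑ w, if H.Adj v w then f w else 0 := by
  rw [shift, ← Finset.sum_filter]
  refine Finset.sum_congr ?_ fun _ _ => rfl
  ext w
  simp

universe v

variable {V : Type v} [Fintype V] (H : SimpleGraph V) [H.LocallyFinite] (v₀ : V)
  (p : ℝ≥0∞) [Fact (1 ≤ p)]

variable {H v₀ p} in
theorem mem_pointSpectrum_of_solution {z : ℂ} {f : V → ℂ} {g : ℕ → ℂ} (hf : f ≠ 0)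
    (hg : Memℓp g p) (h0 : shift H f v₀ + g 0 = z * f v₀)
    (hH : ∀ v, v ≠ v₀ → shift H f v = z * f v) (h1 : f v₀ + g 1 = z * g 0)
    (hT : ∀ k, g k + g (k + 2) = z * g (k + 1)) :
    z ∈ pointSpectrum (attachTailShift H v₀ p) := by
  have hfin : Memℓp (Sum.elim f (0 : ℕ → ℂ)) p := by
    have h : Memℓp (Sum.elim f (0 : ℕ → ℂ)) 0 :=
      memℓp_zero ((Set.finite_range (Sum.inl : V → V ⊕ ℕ)).subset fun x hx => by
        rcases x with a | k
        · exact ⟨a, rfl⟩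
        · exact absurd rfl hx)
    exact h.of_exponent_ge zero_le
  set x : lp (fun _ : V ⊕ ℕ => ℂ) p :=
    ⟨Sum.elim f (0 : ℕ → ℂ), hfin⟩ + extendTail V p ⟨g, hg⟩ with hx
  have hl : ∀ v, x (Sum.inl v) = f v := fun v => add_zero (f v)
  have hr : ∀ k, x (Sum.inr k) = g k := fun k => zero_add (g k)
  refine mem_pointSpectrum_iff.2 ⟨x, ?_, ?_⟩
  · intro h
    refine hf (funext fun v => ?_)
    rw [← hl v, h]
    rfl
  · refine lp.ext (funext fun y => ?_)
    change shift (attachTail H v₀) x y = z * x y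
    rcases y with v | k
    · by_cases hv : v = v₀
      · subst hv
        rw [shift_attachTail_inl_self]
        simp only [hl, hr]
        exact h0
      · rw [shift_attachTail_inl_of_ne H v₀ x hv]
        simp only [hl]
        exact hH v hv
    · rcases k with _ | k
      · rw [shift_attachTail_inr_zero, hl, hr, hr, h1]
      · rw [shift_attachTail_inr_succ, hr, hr, hr, hT]

theorem memℓp_geometric {b : ℂ} (hb : ‖b‖ < 1) : Memℓp (fun k : ℕ => b ^ (k + 1)) p := by
  have h : Memℓp (fun k : ℕ => b ^ (k + 1)) 1 := by
    refine memℓp_gen ?_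
    simp only [ENNReal.toReal_one, Real.rpow_one, norm_pow]
    exact (summable_nat_add_iff 1).2 (summable_geometric_of_lt_one (norm_nonneg b) hb)
  exact h.of_exponent_ge Fact.out

/-- A solution vanishing at `v₀` is continued by zero along the tail, one normalised at `v₀` by `b ^
(k + 1)` at `u_{k+1}`. -/
theorem finiteSystemEigenvalues_subset_pointSpectrum :
    finiteSystemEigenvalues H v₀ ⊆ pointSpectrum (attachTailShift H v₀ p) := by
  rintro z (⟨f, hf, hf0, hfz⟩ | ⟨b, hb0, hb, rfl, f, hf0, hfz, hH⟩)
  · refine mem_pointSpectrum_of_solution (g := 0) hf zero_memℓp ?_ (fun v _ => hfz v) ?_ ?_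
    · simpa using hfz v₀
    · simpa using hf0
    · simp
  · refine mem_pointSpectrum_of_solution (f := f) ?_ (memℓp_geometric p hb) ?_ hH ?_ ?_
    · rintro rfl
      simp at hf0
    · simpa using hfz
    · rw [hf0]
      field_simp
      ring
    · intro k
      field_simp
      ring

/-- If the eigenvector vanishes at `v₀` it vanishes on the tail, and its restriction to `H` is of
the first type; otherwise it is rescaled to `1` at `v₀`. For `p = ∞` the band is excluded because
the recursion has bounded solutions there that do not decay. -/
theorem mem_finiteSystemEigenvalues_of_mem_pointSpectrum {z : ℂ}
    (hz : z ∈ pointSpectrum (attachTailShift H v₀ p)) (h : p ≠ ∞ ∨ z ∉ band) :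
    z ∈ finiteSystemEigenvalues H v₀ := by
  obtain ⟨x, hx0, hx⟩ := mem_pointSpectrum_iff.1 hz
  have hxe : ∀ y, shift (attachTail H v₀) x y = z * x y := fun y =>
    congrFun (congrArg (fun g : lp (fun _ : V ⊕ ℕ => ℂ) p => (g : V ⊕ ℕ → ℂ)) hx) y
  set f : V → ℂ := fun v => x (Sum.inl v) with hf
  -- With the value at `v₀` put in front, the equation at `u_1` becomes the first instance of the
  -- recursion.
  set a : ℕ → ℂ := fun k => Nat.casesOn k (x (Sum.inl v₀)) (fun j => x (Sum.inr j)) with ha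
  obtain ⟨b, hb0, hb1, rfl⟩ := exists_eq_add_inv z
  have hrec : ∀ k, a k + a (k + 2) = (b + b⁻¹) * a (k + 1) := by
    intro k
    rcases k with _ | k
    · exact (shift_attachTail_inr_zero H v₀ x).symm.trans (hxe _)
    · exact (shift_attachTail_inr_succ H v₀ x k).symm.trans (hxe _)
  have hself : shift H f v₀ + a 1 = (b + b⁻¹) * f v₀ :=
    (shift_attachTail_inl_self H v₀ x).symm.trans (hxe _)
  have hne : ∀ v, v ≠ v₀ → shift H f v = (b + b⁻¹) * f v := fun v hv =>
    (shift_attachTail_inl_of_ne H v₀ x hv).symm.trans (hxe _)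
  have hbd : ∀ k, ‖a k‖ ≤ ‖x‖ := by
    intro k
    rcases k with _ | k <;> exact lp.norm_apply_le_norm ne_zero_of_fact_one_le x _
  have hpow : ∀ k, a k = b ^ k * a 0 ∧ (‖b‖ < 1 ∨ a 0 = 0) := by
    intro k
    rcases hb1.lt_or_eq with hb | hb
    · exact ⟨eq_pow_mul_of_recursion_of_bounded hb0 hb hrec hbd k, Or.inl hb⟩
    · have hp : p ≠ ∞ := h.resolve_right fun h => h (add_inv_mem_band hb)
      have hlim : Filter.Tendsto a Filter.atTop (nhds 0) :=
        (Filter.tendsto_add_atTop_iff_nat 1).1 (tendsto_tail_zero p hp x)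
      have h0 := eq_zero_of_recursion_of_tendsto hb hrec hlim
      exact ⟨by rw [h0 k, h0 0, mul_zero], Or.inr (h0 0)⟩
  by_cases ha0 : a 0 = 0
  · have hak : ∀ k, a k = 0 := fun k => by rw [(hpow k).1, ha0, mul_zero]
    refine Or.inl ⟨f, ?_, ha0, fun v => ?_⟩
    · intro hf0
      refine hx0 (lp.ext (funext fun y => ?_))
      rcases y with v | k
      · exact congrFun hf0 v
      · exact hak (k + 1)
    · by_cases hv : v = v₀
      · subst hv
        rw [← hself, hak 1, add_zero]
      · exact hne v hv
  · have hb : ‖b‖ < 1 := (hpow 0).2.resolve_right ha0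
    have hshift : ∀ v, shift H (fun w => (a 0)⁻¹ * f w) v = (a 0)⁻¹ * shift H f v :=
      fun v => (Finset.mul_sum _ _ _).symm
    have hfa : f v₀ = a 0 := rfl
    refine Or.inr ⟨b, hb0, hb, by rw [one_div], fun v => (a 0)⁻¹ * f v,
      inv_mul_cancel₀ ha0, ?_, fun v hv => ?_⟩
    · rw [hshift]
      have h1 := (hpow 1).1
      rw [pow_one] at h1
      rw [h1] at hself
      have h2 : shift H f v₀ = (b + b⁻¹) * f v₀ - b * a 0 := by rw [← hself]; ring
      change (a 0)⁻¹ * shift H f v₀ + b = (b + b⁻¹) * ((a 0)⁻¹ * f v₀)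
      rw [h2, hfa]
      field_simp
      ring
    · rw [hshift, hne v hv]
      ring

theorem pointSpectrum_attachTailShift (hp : p ≠ ∞) :
    pointSpectrum (attachTailShift H v₀ p) = finiteSystemEigenvalues H v₀ :=
  Set.Subset.antisymm
    (fun _ hz => mem_finiteSystemEigenvalues_of_mem_pointSpectrum H v₀ p hz (Or.inl hp))
    (finiteSystemEigenvalues_subset_pointSpectrum H v₀ p)

theorem spectrum_attachTailShift :
    spectrum ℂ (attachTailShift H v₀ p) = band ∪ finiteSystemEigenvalues H v₀ := by
  rw [spectrum_attachTailShift_eq_union_pointSpectrum]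
  refine Set.Subset.antisymm (fun z hz => ?_)
    (Set.union_subset_union_right _ (finiteSystemEigenvalues_subset_pointSpectrum H v₀ p))
  by_cases hb : z ∈ band
  · exact Or.inl hb
  · exact Or.inr (mem_finiteSystemEigenvalues_of_mem_pointSpectrum H v₀ p
      (hz.resolve_left hb) (Or.inr hb))

/-- The number `b` in the second finite system is real, since the adjacency matrix is Hermitian. -/
theorem im_eq_zero_of_finiteSystem {b z : ℂ} (hb0 : b ≠ 0) (hb : ‖b‖ < 1) (hz : z = b + 1 / b)
    {f : V → ℂ} (hf0 : f v₀ = 1) (hfz : shift H f v₀ + b = z * f v₀)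
    (hH : ∀ v, v ≠ v₀ → shift H f v = z * f v) : b.im = 0 := by
  classical
  have hreal : (∑ v, (starRingEnd ℂ) (f v) * shift H f v).im = 0 := by
    rw [← Complex.conj_eq_iff_im, map_sum]
    simp only [shift_eq_sum_ite, map_mul, Complex.conj_conj, map_sum, Finset.mul_sum]
    rw [Finset.sum_comm]
    refine Finset.sum_congr rfl fun v _ => Finset.sum_congr rfl fun w _ => ?_
    rw [H.adj_comm w v]
    split_ifs
    · ring
    · simp
  have hsum : ∑ v, (starRingEnd ℂ) (f v) * shift H f v =
      z * ((∑ v, ‖f v‖ ^ 2 : ℝ) : ℂ) - b := by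
    have h2 : ∀ v, (starRingEnd ℂ) (f v) * shift H f v =
        z * ((‖f v‖ ^ 2 : ℝ) : ℂ) - if v = v₀ then b else 0 := by
      intro v
      have h3 : ((‖f v‖ ^ 2 : ℝ) : ℂ) = (starRingEnd ℂ) (f v) * f v := by
        rw [mul_comm, Complex.mul_conj, Complex.normSq_eq_norm_sq]
      rw [h3]
      split_ifs with hv
      · subst hv
        rw [hf0, map_one] at *
        linear_combination hfz
      · rw [hH v hv]
        ring
    simp only [h2]
    rw [Finset.sum_sub_distrib, ← Finset.mul_sum, Finset.sum_ite_eq' Finset.univ v₀,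
      if_pos (Finset.mem_univ _), Complex.ofReal_sum]
  rw [hsum, Complex.sub_im, Complex.im_mul_ofReal, hz, Complex.add_im, one_div,
    Complex.inv_im] at hreal
  set s := ∑ v, ‖f v‖ ^ 2 with hs
  have hs0 : 0 ≤ s := Finset.sum_nonneg fun _ _ => by positivity
  set n := Complex.normSq b with hn
  have hn0 : 0 < n := Complex.normSq_pos.2 hb0
  have hn1 : n < 1 := by
    rw [hn, Complex.normSq_eq_norm_sq]
    nlinarith [norm_nonneg b]
  -- The imaginary part of `z s - b`, with `Im z = Im b (1 - 1/n)` and `n = |b|²`, multiplied by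
  -- `-n`; the second factor is positive since `0 < n < 1`.
  have h4 : b.im * (n + (1 - n) * s) = 0 := by
    have h5 := congrArg (· * n) hreal
    simp only [zero_mul] at h5
    have h6 : -b.im / n * n = -b.im := div_mul_cancel₀ _ hn0.ne'
    linear_combination -h5 + s * h6
  rcases mul_eq_zero.1 h4 with h | h
  · exact h
  · nlinarith [mul_nonneg (sub_nonneg.2 hn1.le) hs0]

end Eigenvalues

/-! ### The fly-swatter -/

section FlySwatter

theorem shift_top {V : Type*} [Fintype V] [(⊤ : SimpleGraph V).LocallyFinite] (f : V → ℂ) (v : V) :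
    shift (⊤ : SimpleGraph V) f v = (∑ w, f w) - f v := by
  classical
  have h : (⊤ : SimpleGraph V).neighborFinset v = Finset.univ.erase v := by
    ext w
    simp [eq_comm]
  rw [shift, h, Finset.sum_erase_eq_sub (Finset.mem_univ v)]

theorem flySwatterRoot_sq_add {n : ℕ} (hn : 2 ≤ n) :
    ((n : ℝ) - 1) * (flySwatterRoot n ^ 2 + flySwatterRoot n) = 1 := by
  have hn' : (2 : ℝ) ≤ n := by exact_mod_cast hn
  have h1 : (0 : ℝ) < (n : ℝ) - 1 := by linarith
  have hs := Real.sq_sqrt (div_nonneg (by linarith : (0 : ℝ) ≤ (n : ℝ) + 3) h1.le)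
  have h2 : flySwatterRoot n ^ 2 + flySwatterRoot n = (((n : ℝ) + 3) / ((n : ℝ) - 1) - 1) / 4 := by
    rw [← hs, flySwatterRoot]
    ring
  rw [h2]
  field_simp
  ring

theorem ofReal_flySwatterRoot_sq_add {n : ℕ} (hn : 2 ≤ n) :
    ((n : ℂ) - 1) * ((flySwatterRoot n : ℂ) ^ 2 + flySwatterRoot n) = 1 := by
  exact_mod_cast congrArg ((↑) : ℝ → ℂ) (flySwatterRoot_sq_add hn)

theorem flySwatterRoot_pos {n : ℕ} (hn : 2 ≤ n) : 0 < flySwatterRoot n := by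
  have hn' : (2 : ℝ) ≤ n := by exact_mod_cast hn
  have h1 : (0 : ℝ) < (n : ℝ) - 1 := by linarith
  have h2 : 1 < Real.sqrt (((n : ℝ) + 3) / ((n : ℝ) - 1)) := by
    rw [Real.lt_sqrt zero_le_one, lt_div_iff₀ h1]
    linarith
  rw [flySwatterRoot]
  linarith

theorem flySwatterRoot_lt_one {n : ℕ} (hn : 2 ≤ n) : flySwatterRoot n < 1 := by
  have hn' : (2 : ℝ) ≤ n := by exact_mod_cast hn
  have h0 := flySwatterRoot_pos hn
  have h1 := flySwatterRoot_sq_add hn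
  nlinarith [mul_nonneg (by linarith : (0 : ℝ) ≤ (n : ℝ) - 2)
    (by positivity : 0 ≤ flySwatterRoot n ^ 2 + flySwatterRoot n)]

/-- The other root is `-(1 + r)`, outside the unit disc. -/
theorem eq_flySwatterRoot {n : ℕ} (hn : 2 ≤ n) {b : ℂ} (hb : ‖b‖ < 1)
    (h : ((n : ℂ) - 1) * (b ^ 2 + b) = 1) : b = flySwatterRoot n := by
  set r := flySwatterRoot n with hr
  have hr0 : 0 < r := flySwatterRoot_pos hn
  have hn' : (n : ℂ) - 1 ≠ 0 := by
    rw [sub_ne_zero]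
    exact_mod_cast (by omega : n ≠ 1)
  have h1 : ((n : ℂ) - 1) * ((r : ℂ) ^ 2 + r) = 1 := ofReal_flySwatterRoot_sq_add hn
  have h2 : (b - r) * (b + 1 + r) = 0 := by
    refine (mul_right_inj' hn').1 ?_
    linear_combination h - h1
  rcases mul_eq_zero.1 h2 with h3 | h3
  · exact sub_eq_zero.1 h3
  · exfalso
    have h4 : b = ((-(1 + r) : ℝ) : ℂ) := by
      push_cast
      linear_combination h3
    rw [h4, Complex.norm_real, norm_neg, Real.norm_of_nonneg (by linarith)] at hb
    linarith

theorem finiteSystemEigenvalues_top {n : ℕ} (hn : 2 ≤ n)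
    [(⊤ : SimpleGraph (Fin (n + 1))).LocallyFinite] :
    finiteSystemEigenvalues (⊤ : SimpleGraph (Fin (n + 1))) 0 =
      {-1, ((flySwatterRoot n + 1 / flySwatterRoot n : ℝ) : ℂ)} := by
  have hr0 := flySwatterRoot_pos hn
  have hr1 := flySwatterRoot_lt_one hn
  ext z
  constructor
  · rintro (⟨f, hf, hf0, hfz⟩ | ⟨b, hb0, hb, hz, f, hf0, hfz, hH⟩)
    · left
      simp only [shift_top] at hfz
      have hs := hfz 0
      rw [hf0, sub_zero, mul_zero] at hs
      obtain ⟨v, hv⟩ := Function.ne_iff.1 hf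
      have h := hfz v
      rw [hs] at h
      refine mul_right_cancel₀ hv ?_
      rw [← h]
      simp
    · right
      simp only [shift_top] at hfz hH
      set σ := ∑ w, f w with hσ
      have hσb : b * σ = b + 1 := by
        rw [hf0, hz] at hfz
        field_simp at hfz
        linear_combination hfz
      -- Away from `v₀` the equation reads `(z + 1) f v = σ`. Summing over these `n` vertices avoids
      -- dividing by `z + 1`.
      have hsum : (z + 1) * (σ - 1) = n * σ := by
        have h1 : σ = f 0 + ∑ i : Fin n, f i.succ := Fin.sum_univ_succ f
        rw [hf0] at h1
        rw [h1, add_sub_cancel_left, ← h1, Finset.mul_sum]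
        have h2 : ∀ i : Fin n, (z + 1) * f i.succ = σ := fun i => by
          linear_combination -hH i.succ (Fin.succ_ne_zero i)
        simp [h2]
      have hb2 : ((n : ℂ) - 1) * (b ^ 2 + b) = 1 := by
        have hzb : b * z = b ^ 2 + 1 := by
          rw [hz]
          field_simp
        linear_combination (-b ^ 2) * hsum - (n * b - b * z - b) * hσb + hzb
      have h := eq_flySwatterRoot hn hb hb2
      rw [Set.mem_singleton_iff, hz, h]
      push_cast
      rfl
  · rintro (rfl | hz)
    · left
      have h1 : (⟨1, by omega⟩ : Fin (n + 1)) ≠ ⟨2, by omega⟩ := by simp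
      set f : Fin (n + 1) → ℂ := Pi.single ⟨1, by omega⟩ 1 - Pi.single ⟨2, by omega⟩ 1 with hf
      have hsum : ∑ w, f w = 0 := by simp [hf]
      refine ⟨f, ?_, ?_, fun v => ?_⟩
      · intro h
        have := congrFun h ⟨1, by omega⟩
        simp [hf] at this
      · simp [hf, Fin.ext_iff]
      · rw [shift_top, hsum]
        ring
    · right
      set b : ℂ := (flySwatterRoot n : ℂ) with hb
      have hb0 : b ≠ 0 := Complex.ofReal_ne_zero.2 hr0.ne'
      have hd : b ^ 2 + b + 1 ≠ 0 := by
        have : flySwatterRoot n ^ 2 + flySwatterRoot n + 1 ≠ 0 := by positivity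
        rw [hb]
        exact_mod_cast this
      have h1 : ((n : ℂ) - 1) * (b ^ 2 + b) = 1 := ofReal_flySwatterRoot_sq_add hn
      have hz' : z = b + 1 / b := by
        rw [hz, hb]
        push_cast
        rfl
      -- The common value off `v₀`: the equation at `v₀` forces the total `(b + 1) / b`, and then
      -- `(z + 1) t = (b + 1) / b`.
      obtain ⟨t, ht⟩ : ∃ t : ℂ, t * (b ^ 2 + b + 1) = b + 1 :=
        ⟨(b + 1) / (b ^ 2 + b + 1), div_mul_cancel₀ _ hd⟩
      have hnt : n * t * b = 1 := by
        refine mul_right_cancel₀ hd ?_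
        linear_combination (n * b) * ht + h1
      set f : Fin (n + 1) → ℂ := Fin.cons 1 fun _ => t with hf
      have hsum : ∑ w, f w = (b + 1) / b := by
        rw [Fin.sum_univ_succ]
        simp only [hf, Fin.cons_zero, Fin.cons_succ, Finset.sum_const, Finset.card_univ,
          Fintype.card_fin, nsmul_eq_mul]
        rw [eq_div_iff hb0]
        linear_combination hnt
      refine ⟨b, hb0, ?_, hz', f, rfl, ?_, fun v hv => ?_⟩
      · rw [hb, Complex.norm_real, Real.norm_of_nonneg hr0.le]
        exact hr1
      · rw [shift_top, hsum, hz']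
        change (b + 1) / b - 1 + b = (b + 1 / b) * 1
        field_simp
        ring
      · obtain ⟨i, rfl⟩ := Fin.exists_succ_eq.2 hv
        rw [shift_top, hsum, hz']
        simp only [hf, Fin.cons_succ]
        field_simp
        linear_combination -ht

end FlySwatter

/-! ### The comb -/

section Comb

/-- The solution of `g_{k+2} = μ g_{k+1} - g_k` with `g_0 = 1` and `g_1 = μ`. -/
def combSeq (μ : ℂ) : ℕ → ℂ
  | 0 => 1
  | 1 => μ
  | k + 2 => μ * combSeq μ (k + 1) - combSeq μ k

/-- Two consecutive zeros would propagate down to the initial value `1`. -/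
theorem combSeq_succ_ne_zero (μ : ℂ) (k : ℕ) (hk : combSeq μ k = 0) : combSeq μ (k + 1) ≠ 0 := by
  induction k with
  | zero => simp [combSeq] at hk
  | succ k ih =>
    intro h
    rw [combSeq, hk, mul_zero, zero_sub, neg_eq_zero] at h
    exact ih h hk

/-- The hypothesis is `μ = z - 1/z` for `z = b + 1/b`, cleared of denominators. With `c = b (b² +
1)`, the scaled quantity `c ^ n (g_n - b g_{n-1})` obeys a recursion with coefficients `μ c` and
`c²`, which is that of `h_n`. -/
theorem eval_combPoly {b μ : ℂ} (hμ : μ * (b * (b ^ 2 + 1)) = b ^ 4 + b ^ 2 + 1) :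
    ∀ n : ℕ, (combPoly (n + 1)).eval b =
      (b * (b ^ 2 + 1)) ^ (n + 1) * (combSeq μ (n + 1) - b * combSeq μ n)
  | 0 => by
    simp only [combPoly, combSeq, Polynomial.eval_one]
    linear_combination -hμ
  | 1 => by
    simp only [combPoly, combSeq, Polynomial.eval_add, Polynomial.eval_sub, Polynomial.eval_neg,
      Polynomial.eval_pow, Polynomial.eval_X, Polynomial.eval_one]
    linear_combination (-μ * (b * (b ^ 2 + 1)) - (b ^ 4 + b ^ 2 + 1) + b * (b * (b ^ 2 + 1))) * hμ
  | n + 2 => by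
    have h1 := eval_combPoly hμ n
    have h2 := eval_combPoly hμ (n + 1)
    rw [show n + 1 + 1 = n + 2 from rfl] at h2
    rw [show n + 2 + 1 = n + 3 from rfl, combPoly]
    simp only [Polynomial.eval_add, Polynomial.eval_sub, Polynomial.eval_mul,
      Polynomial.eval_pow, Polynomial.eval_X, Polynomial.eval_one, h1, h2, ← hμ]
    rw [show combSeq μ (n + 3) = μ * combSeq μ (n + 2) - combSeq μ (n + 1) from rfl,
      show combSeq μ (n + 2) = μ * combSeq μ (n + 1) - combSeq μ n from rfl]
    ring

theorem eval_combPoly_zero : ∀ n : ℕ, (combPoly (n + 1)).eval 0 = 1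
  | 0 => by simp [combPoly]
  | 1 => by simp [combPoly]
  | n + 2 => by
    have h2 := eval_combPoly_zero (n + 1)
    rw [show n + 1 + 1 = n + 2 from rfl] at h2
    rw [show n + 2 + 1 = n + 3 from rfl, combPoly]
    simp [h2]

variable {n : ℕ} [(comb n).LocallyFinite]

theorem shift_comb_inr (f : Fin n ⊕ Fin n → ℂ) (i : Fin n) :
    shift (comb n) f (Sum.inr i) = f (Sum.inl i) := by
  have h : (comb n).neighborFinset (Sum.inr i) = {Sum.inl i} := by
    ext y
    rw [SimpleGraph.mem_neighborFinset, Finset.mem_singleton]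
    rcases y with j | j
    · change i = j ↔ _
      simp [eq_comm]
    · change False ↔ _
      simp
  rw [shift, h, Finset.sum_singleton]

/-- Reading the path values from a sequence on `ℕ` keeps index shifts out of `Fin n`; the sum over
`j + 1 = i` is empty at the first vertex. -/
theorem shift_comb_inl {f : Fin n ⊕ Fin n → ℂ} {G : ℕ → ℂ} (hG : ∀ i : Fin n, f (Sum.inl i) = G i)
    (i : Fin n) :
    shift (comb n) f (Sum.inl i) = (∑ j ∈ Finset.range n, if j + 1 = i then G j else 0) +
      (if (i : ℕ) + 1 < n then G (i + 1) else 0) + f (Sum.inr i) := by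
  classical
  rw [shift_eq_sum_ite, Fintype.sum_sum_type]
  congr 1
  · have h1 : ∀ j : Fin n, (if (comb n).Adj (Sum.inl i) (Sum.inl j) then f (Sum.inl j) else 0) =
        (if (j : ℕ) + 1 = i then G j else 0) + if (i : ℕ) + 1 = j then G j else 0 := by
      intro j
      have h2 : (comb n).Adj (Sum.inl i) (Sum.inl j) ↔ (i : ℕ) + 1 = j ∨ (j : ℕ) + 1 = i := Iff.rfl
      simp only [h2, hG]
      split_ifs <;> first | omega | simp
    simp only [h1, Finset.sum_add_distrib]
    rw [Fin.sum_univ_eq_sum_range (fun j => if j + 1 = (i : ℕ) then G j else 0) n,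
      Fin.sum_univ_eq_sum_range (fun j => if (i : ℕ) + 1 = j then G j else 0) n,
      Finset.sum_ite_eq]
    simp only [Finset.mem_range]
  · have h1 : ∀ j : Fin n, (if (comb n).Adj (Sum.inl i) (Sum.inr j) then f (Sum.inr j) else 0) =
        if i = j then f (Sum.inr j) else 0 := by
      intro j
      have h2 : (comb n).Adj (Sum.inl i) (Sum.inr j) ↔ i = j := Iff.rfl
      simp only [h2]
    simp only [h1]
    rw [Finset.sum_ite_eq Finset.univ i, if_pos (Finset.mem_univ _)]

theorem shift_comb_inl_zero {f : Fin n ⊕ Fin n → ℂ} {G : ℕ → ℂ}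
    (hG : ∀ i : Fin n, f (Sum.inl i) = G i) (hn : 0 < n) :
    shift (comb n) f (Sum.inl ⟨0, hn⟩) =
      (if 1 < n then G 1 else 0) + f (Sum.inr ⟨0, hn⟩) := by
  rw [shift_comb_inl hG]
  simp

theorem shift_comb_inl_succ {f : Fin n ⊕ Fin n → ℂ} {G : ℕ → ℂ}
    (hG : ∀ i : Fin n, f (Sum.inl i) = G i) {k : ℕ} (hk : k + 1 < n) :
    shift (comb n) f (Sum.inl ⟨k + 1, hk⟩) =
      G k + (if k + 2 < n then G (k + 2) else 0) + f (Sum.inr ⟨k + 1, hk⟩) := by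
  rw [shift_comb_inl hG]
  congr 2
  simp only [add_left_inj]
  rw [Finset.sum_ite_eq', if_pos (Finset.mem_range.2 (by omega))]

/-- Away from the last vertex of the path, a solution of the eigenvalue equations on the comb is
determined by its value at the first vertex. -/
theorem comb_solution {z : ℂ} (hz : z ≠ 0) (hn : 2 ≤ n) {f : Fin n ⊕ Fin n → ℂ}
    (hf : ∀ v, v ≠ Sum.inl ⟨n - 1, by omega⟩ → shift (comb n) f v = z * f v) :
    (∀ i, f (Sum.inr i) = z⁻¹ * f (Sum.inl i)) ∧
      ∀ i : Fin n, f (Sum.inl i) = f (Sum.inl ⟨0, by omega⟩) * combSeq (z - z⁻¹) i := by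
  -- The equation at a pendant vertex eliminates it, turning `z` into `z - z⁻¹` on the path.
  have hr : ∀ i, f (Sum.inr i) = z⁻¹ * f (Sum.inl i) := by
    intro i
    have h := hf (Sum.inr i) (by simp)
    rw [shift_comb_inr] at h
    rw [h, inv_mul_cancel_left₀ hz]
  refine ⟨hr, ?_⟩
  set G : ℕ → ℂ := fun k => if h : k < n then f (Sum.inl ⟨k, h⟩) else 0 with hGdef
  have hG : ∀ i : Fin n, f (Sum.inl i) = G i := fun i => by simp [hGdef]
  have key : ∀ k, (k < n → G k = G 0 * combSeq (z - z⁻¹) k) ∧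
      (k + 1 < n → G (k + 1) = G 0 * combSeq (z - z⁻¹) (k + 1)) := by
    intro k
    induction k with
    | zero =>
      refine ⟨fun _ => by simp [combSeq], fun h => ?_⟩
      have h1 := hf (Sum.inl ⟨0, by omega⟩) (by simp; omega)
      rw [shift_comb_inl_zero hG, hr, hG, if_pos (by omega)] at h1
      simp only [combSeq]
      linear_combination h1
    | succ k ih =>
      refine ⟨ih.2, fun h => ?_⟩
      have h1 := hf (Sum.inl ⟨k + 1, by omega⟩) (by simp; omega)
      rw [shift_comb_inl_succ hG, hr, hG, if_pos (by omega)] at h1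
      have e1 := ih.1 (by omega)
      have e2 := ih.2 (by omega)
      simp only at h1
      rw [e1, e2] at h1
      rw [show k + 1 + 1 = k + 2 from rfl, combSeq]
      linear_combination h1
  intro i
  rw [hG, hG]
  exact (key i).1 i.2

/-- No nonzero solution on the comb vanishes at `v_n`: for `z ≠ 0` the equation there would give two
consecutive zeros of a multiple of `combSeq`, and `z = 0` is checked directly. In the second system
the equation at `v_n` says `g_n = b g_{n-1}`, that is `h_n(b) = 0`. -/
theorem finiteSystemEigenvalues_comb (hn : 2 ≤ n) :
    finiteSystemEigenvalues (comb n) (Sum.inl ⟨n - 1, by omega⟩) = combEigenvalues n := by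
  obtain ⟨m, rfl⟩ : ∃ m, n = m + 2 := ⟨n - 2, by omega⟩
  -- This ensures `z = (b² + 1) / b ≠ 0`, so the pendant vertices can be eliminated.
  have hsq : ∀ b : ℂ, ‖b‖ < 1 → b ^ 2 + 1 ≠ 0 := by
    intro b hb h
    have h1 : b ^ 2 = -1 := by linear_combination h
    have h2 : ‖b‖ ^ 2 = 1 := by rw [← norm_pow, h1, norm_neg, norm_one]
    nlinarith [norm_nonneg b]
  have hμ : ∀ b : ℂ, b ≠ 0 → b ^ 2 + 1 ≠ 0 → b + 1 / b ≠ 0 ∧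
      ((b + 1 / b) - (b + 1 / b)⁻¹) * (b * (b ^ 2 + 1)) = b ^ 4 + b ^ 2 + 1 := by
    intro b hb0 hb2
    have e : b + 1 / b = (b ^ 2 + 1) / b := by field_simp
    rw [e]
    refine ⟨div_ne_zero hb2 hb0, ?_⟩
    rw [inv_div]
    field_simp
    ring
  ext z
  constructor
  · rintro (⟨f, hf, hf0, hfz⟩ | ⟨b, hb0, hb, hz, f, hf0, hfz, hH⟩)
    · exfalso
      by_cases hz : z = 0
      · subst hz
        have hl : ∀ i, f (Sum.inl i) = 0 := fun i => by
          rw [← shift_comb_inr f i, hfz, zero_mul]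
        have hr : ∀ i, f (Sum.inr i) = 0 := fun i => by
          have h := hfz (Sum.inl i)
          rw [shift_comb_inl (G := 0) hl, zero_mul] at h
          simpa using h
        refine hf (funext fun v => ?_)
        rcases v with i | i
        · exact hl i
        · exact hr i
      · obtain ⟨hr, hl⟩ := comb_solution hz hn (f := f) fun v _ => hfz v
        set c := f (Sum.inl ⟨0, by omega⟩) with hc
        have hlast : c * combSeq (z - z⁻¹) (m + 1) = 0 := by
          rw [← hf0]
          exact (hl ⟨m + 1, by omega⟩).symm
        have h := hfz (Sum.inl ⟨m + 1, by omega⟩)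
        rw [shift_comb_inl_succ (G := fun k => c * combSeq (z - z⁻¹) k) hl, if_neg (by omega), hr,
          hl]
          at h
        simp only [hlast, mul_zero, add_zero] at h
        have hc0 : c = 0 := by
          rcases mul_eq_zero.1 h with h1 | h1
          · exact h1
          · exact (mul_eq_zero.1 hlast).resolve_right (combSeq_succ_ne_zero _ _ h1)
        refine hf (funext fun v => ?_)
        rcases v with i | i
        · rw [hl, hc0, zero_mul]
          rfl
        · rw [hr, hl, hc0, zero_mul, mul_zero]
          rfl
    · have hb2 := hsq b hb
      obtain ⟨hz0, hμb⟩ := hμ b hb0 hb2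
      rw [← hz] at hz0 hμb
      obtain ⟨hr, hl⟩ := comb_solution hz0 hn hH
      set c := f (Sum.inl ⟨0, by omega⟩) with hc
      have hlast : c * combSeq (z - z⁻¹) (m + 1) = 1 := by
        rw [← hf0]
        exact (hl ⟨m + 1, by omega⟩).symm
      have h : shift (comb (m + 2)) f (Sum.inl ⟨m + 1, by omega⟩) + b =
        z * f (Sum.inl ⟨m + 1, by omega⟩) := hfz
      rw [shift_comb_inl_succ (G := fun k => c * combSeq (z - z⁻¹) k) hl, if_neg (by omega), hr,
          hl]
        at h
      simp only at h
      refine ⟨b, hb, ?_, hz⟩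
      rw [show m + 2 = m + 1 + 1 from rfl, eval_combPoly hμb]
      refine mul_eq_zero_of_right _ ?_
      have hc0 : c ≠ 0 := left_ne_zero_of_mul_eq_one hlast
      refine (mul_right_inj' hc0).1 ?_
      rw [show m + 1 + 1 = m + 2 from rfl, combSeq]
      linear_combination (-b) * hlast - h
  · rintro ⟨b, hb, hroot, hz⟩
    right
    have hb0 : b ≠ 0 := by
      rintro rfl
      rw [show m + 2 = m + 1 + 1 from rfl, eval_combPoly_zero] at hroot
      exact one_ne_zero hroot
    have hb2 := hsq b hb
    obtain ⟨hz0, hμb⟩ := hμ b hb0 hb2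
    rw [← hz] at hz0 hμb
    set μ := z - z⁻¹ with hμdef
    rw [show m + 2 = m + 1 + 1 from rfl, eval_combPoly hμb, mul_eq_zero,
      or_iff_right (pow_ne_zero _ (mul_ne_zero hb0 hb2)), sub_eq_zero] at hroot
    have hg : combSeq μ (m + 1) ≠ 0 := by
      intro h
      rw [h, mul_zero] at hroot
      exact combSeq_succ_ne_zero μ _ h hroot
    set G : ℕ → ℂ := fun k => combSeq μ k / combSeq μ (m + 1) with hGdef
    set f : Fin (m + 2) ⊕ Fin (m + 2) → ℂ := Sum.elim (fun i => G i) (fun i => z⁻¹ * G i) with hf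
    have hl : ∀ i : Fin (m + 2), f (Sum.inl i) = G i := fun i => rfl
    have hr : ∀ i : Fin (m + 2), f (Sum.inr i) = z⁻¹ * G i := fun i => rfl
    have hrec : ∀ k, G k + G (k + 2) + z⁻¹ * G (k + 1) = z * G (k + 1) := by
      intro k
      simp only [hGdef]
      rw [combSeq, hμdef]
      ring
    refine ⟨b, hb0, hb, hz, f, div_self hg, ?_, fun v hv => ?_⟩
    · change shift (comb (m + 2)) f (Sum.inl ⟨m + 1, by omega⟩) + b =
        z * f (Sum.inl ⟨m + 1, by omega⟩)
      rw [shift_comb_inl_succ hl, if_neg (by omega), hr, hl]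
      have h1 : G (m + 2) = b := by
        simp only [hGdef]
        rw [show m + 2 = m + 1 + 1 from rfl, hroot, mul_div_cancel_right₀ _ hg]
      have h2 := hrec m
      rw [h1] at h2
      simp only
      linear_combination h2
    · rcases v with ⟨i, hi⟩ | i
      · rcases i with _ | k
        · rw [shift_comb_inl_zero hl, if_pos (by omega), hr, hl]
          simp only [hGdef, combSeq, hμdef]
          ring
        · have hk : k + 2 < m + 2 := by
            have : k + 1 ≠ m + 1 := fun h => hv (by simp [h])
            omega
          rw [shift_comb_inl_succ hl, if_pos hk, hr, hl]
          exact hrec k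
      · rw [shift_comb_inr, hl, hr, mul_inv_cancel_left₀ hz0]

end Comb

/-! ### The kite -/

/-! ### Real roots of `x ^ N + 2 x² - 1` in `(-1, 1)` -/

section KiteRoots

theorem pow_add_two_mul_sq_lt {N : ℕ} {x y : ℝ} (hx : 0 ≤ x) (hxy : x < y) :
    x ^ N + 2 * x ^ 2 - 1 < y ^ N + 2 * y ^ 2 - 1 := by
  have h1 : x ^ N ≤ y ^ N := pow_le_pow_left₀ hx hxy.le N
  nlinarith

theorem exists_pos_root {N : ℕ} (hN : N ≠ 0) :
    ∃ x ∈ Set.Ioo (0 : ℝ) 1, x ^ N + 2 * x ^ 2 - 1 = 0 := by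
  have hc : ContinuousOn (fun x : ℝ => x ^ N + 2 * x ^ 2 - 1) (Set.Icc 0 1) := by fun_prop
  have h := intermediate_value_Ioo zero_le_one hc
  refine h ⟨?_, ?_⟩
  · simp [zero_pow hN]
  · norm_num

/-- The polynomial vanishes at `1`, so the intermediate value theorem is applied up to `9/10`, where
`0.62 > 0.9 ^ 5`; exponent `4` would fail at this point. -/
theorem exists_neg_root {N : ℕ} (hN : 5 ≤ N) :
    ∃ y ∈ Set.Ioo (0 : ℝ) 1, -y ^ N + 2 * y ^ 2 - 1 = 0 := by
  have hc : ContinuousOn (fun x : ℝ => -x ^ N + 2 * x ^ 2 - 1) (Set.Icc 0 (9 / 10)) := by fun_prop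
  have h := intermediate_value_Ioo (by norm_num) hc
  have hpow : (9 / 10 : ℝ) ^ N ≤ (9 / 10) ^ 5 :=
    pow_le_pow_of_le_one (by norm_num) (by norm_num) hN
  obtain ⟨y, ⟨hy0, hy1⟩, hy⟩ := h (a := 0) ⟨by simp [zero_pow (by omega : N ≠ 0)], by
    norm_num at hpow ⊢
    linarith⟩
  exact ⟨y, ⟨hy0, by linarith⟩, hy⟩

/-- Dividing out the root `1` and then `t` turns the equation into `t + ⋯ + t ^ (N - 2) = 1/t + 1`,
whose left side is nondecreasing and whose right side is strictly decreasing. -/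
theorem neg_root_unique {N : ℕ} (hN : 2 ≤ N) {x y : ℝ} (hx : x ∈ Set.Ioo (0 : ℝ) 1)
    (hy : y ∈ Set.Ioo (0 : ℝ) 1) (hPx : -x ^ N + 2 * x ^ 2 - 1 = 0)
    (hPy : -y ^ N + 2 * y ^ 2 - 1 = 0) : x = y := by
  obtain ⟨M, rfl⟩ : ∃ M, N = M + 2 := ⟨N - 2, by omega⟩
  have key : ∀ t : ℝ, t ∈ Set.Ioo (0 : ℝ) 1 → -t ^ (M + 2) + 2 * t ^ 2 - 1 = 0 →
      ∑ i ∈ Finset.range M, t ^ (i + 1) = 1 / t + 1 := by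
    intro t ht h
    have h1 := mul_neg_geom_sum t (M + 2)
    rw [Finset.sum_range_succ', Finset.sum_range_succ'] at h1
    have h2 : ∑ i ∈ Finset.range M, t ^ (i + 1 + 1) = t * ∑ i ∈ Finset.range M, t ^ (i + 1) := by
      rw [Finset.mul_sum]
      exact Finset.sum_congr rfl fun i _ => pow_succ' t (i + 1)
    rw [h2] at h1
    set s := ∑ i ∈ Finset.range M, t ^ (i + 1)
    have ht0 : t ≠ 0 := ht.1.ne'
    have h3 : t * s = 1 + t := by
      refine mul_left_cancel₀ (sub_ne_zero.2 ht.2.ne') ?_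
      simp only [zero_add, pow_one, pow_zero] at h1
      linear_combination h1 + h
    field_simp
    linear_combination h3
  have mono : ∀ s t : ℝ, s ∈ Set.Ioo (0 : ℝ) 1 → t ∈ Set.Ioo (0 : ℝ) 1 →
      -s ^ (M + 2) + 2 * s ^ 2 - 1 = 0 → -t ^ (M + 2) + 2 * t ^ 2 - 1 = 0 → ¬ s < t := by
    intro s t hs ht hPs hPt hst
    have h1 : ∑ i ∈ Finset.range M, s ^ (i + 1) ≤ ∑ i ∈ Finset.range M, t ^ (i + 1) :=
      Finset.sum_le_sum fun i _ => pow_le_pow_left₀ hs.1.le hst.le _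
    rw [key s hs hPs, key t ht hPt] at h1
    have h2 : 1 / t < 1 / s := one_div_lt_one_div_of_lt hs.1 hst
    linarith
  exact le_antisymm (not_lt.1 (mono y x hy hx hPy hPx)) (not_lt.1 (mono x y hx hy hPx hPy))

/-- On `[0, ∞)` the polynomial is strictly increasing. Negative roots mirror the positive one for
even `N`; for odd `N`, necessarily at least `5`, they come from `-t ^ N + 2 t² - 1`. -/
theorem exists_kite_roots {N : ℕ} (hN : 4 ≤ N) :
    ∃ x₁ ∈ Set.Ioo (0 : ℝ) 1, ∃ x₂ ∈ Set.Ioo (-1 : ℝ) 0,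
      {x : ℝ | x ∈ Set.Ioo (-1) 1 ∧ x ^ N + 2 * x ^ 2 - 1 = 0} = {x₁, x₂} := by
  obtain ⟨x₁, hx₁, hP₁⟩ := exists_pos_root (by omega : N ≠ 0)
  have hpos : ∀ x : ℝ, 0 ≤ x → x ^ N + 2 * x ^ 2 - 1 = 0 → x = x₁ := by
    intro x hx hP
    rcases lt_trichotomy x x₁ with h | h | h
    · have := pow_add_two_mul_sq_lt (N := N) hx h
      linarith
    · exact h
    · have := pow_add_two_mul_sq_lt (N := N) hx₁.1.le h
      linarith
  obtain ⟨y, hy, hPy, huniq⟩ : ∃ y ∈ Set.Ioo (0 : ℝ) 1, (-y) ^ N + 2 * (-y) ^ 2 - 1 = 0 ∧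
      ∀ t ∈ Set.Ioo (0 : ℝ) 1, (-t) ^ N + 2 * (-t) ^ 2 - 1 = 0 → t = y := by
    rcases Nat.even_or_odd N with he | ho
    · refine ⟨x₁, hx₁, ?_, fun t ht h => hpos t ht.1.le ?_⟩
      · rw [he.neg_pow, neg_sq]
        exact hP₁
      · rwa [he.neg_pow, neg_sq] at h
    · have h5 : 5 ≤ N := by
        rcases ho with ⟨k, rfl⟩
        omega
      obtain ⟨y, hy, hPy⟩ := exists_neg_root h5
      refine ⟨y, hy, ?_, fun t ht h => ?_⟩
      · rw [ho.neg_pow, neg_sq]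
        exact hPy
      · rw [ho.neg_pow, neg_sq] at h
        exact neg_root_unique (by omega) ht hy h hPy
  refine ⟨x₁, hx₁, -y, ⟨by linarith [hy.2], by linarith [hy.1]⟩, ?_⟩
  ext x
  simp only [Set.mem_ofPred_eq, Set.mem_insert_iff, Set.mem_singleton_iff]
  constructor
  · rintro ⟨hx, hP⟩
    rcases le_or_gt 0 x with h | h
    · exact Or.inl (hpos x h hP)
    · right
      rw [← huniq (-x) ⟨by linarith, by linarith [hx.1]⟩ (by rwa [neg_neg]), neg_neg]
  · rintro (rfl | rfl)
    · exact ⟨⟨by linarith [hx₁.1], hx₁.2⟩, hP₁⟩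
    · exact ⟨⟨by linarith [hy.2], by linarith [hy.1]⟩, hPy⟩

end KiteRoots

/-! ### The finite system on the cycle -/

section Cycle

open scoped Fin.NatCast Fin.CommRing

variable {n : ℕ}

/-- Naming vertices by casts of natural numbers unrolls the cycle into a sequence, to which the
recursion on `ℕ` applies. -/
theorem shift_cycleGraph (hn : 2 ≤ n) [(SimpleGraph.cycleGraph (n + 1)).LocallyFinite]
    (f : Fin (n + 1) → ℂ) (k : ℕ) :
    shift (SimpleGraph.cycleGraph (n + 1)) f ((k + 1 : ℕ) : Fin (n + 1)) =
      f (k : Fin (n + 1)) + f ((k + 2 : ℕ) : Fin (n + 1)) := by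
  obtain ⟨m, rfl⟩ : ∃ m, n = m + 2 := ⟨n - 2, by omega⟩
  have h : (SimpleGraph.cycleGraph (m + 3)).neighborFinset ((k + 1 : ℕ) : Fin (m + 3)) =
      {(k : Fin (m + 3)), ((k + 2 : ℕ) : Fin (m + 3))} := by
    ext w
    rw [SimpleGraph.mem_neighborFinset, Finset.mem_insert, Finset.mem_singleton,
      SimpleGraph.cycleGraph_adj, sub_eq_iff_eq_add', sub_eq_iff_eq_add']
    push_cast
    rw [add_left_inj, eq_comm, add_assoc (k : Fin (m + 3)), one_add_one_eq_two]
  have hne : (k : Fin (m + 3)) ≠ ((k + 2 : ℕ) : Fin (m + 3)) := by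
    push_cast
    rw [Ne, left_eq_add]
    exact ne_of_beq_false rfl
  rw [shift, h, Finset.sum_pair hne]

theorem natCast_self_add_one : ((n + 1 : ℕ) : Fin (n + 1)) = 0 := Fin.natCast_self _

theorem natCast_self_add_two : ((n + 2 : ℕ) : Fin (n + 1)) = 1 := by
  rw [show n + 2 = (n + 1) + 1 from rfl, Nat.cast_succ, natCast_self_add_one, zero_add]

theorem exists_natCast_eq (v : Fin (n + 1)) (hv : v ≠ 0) :
    ∃ k, k < n ∧ v = ((k + 1 : ℕ) : Fin (n + 1)) := by
  have h0 : v.val ≠ 0 := fun h => hv (Fin.ext h)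
  refine ⟨v.val - 1, by omega, ?_⟩
  rw [Nat.sub_add_cancel (by omega), Fin.cast_val_eq_self]

theorem natCast_succ_ne_zero {k : ℕ} (hk : k < n) : ((k + 1 : ℕ) : Fin (n + 1)) ≠ 0 := by
  intro h
  have := congrArg Fin.val h
  rw [Fin.val_natCast, Nat.mod_eq_of_lt (by omega)] at this
  simp at this

/-- The primitive root of unity `exp(2πi/(n+1))`. -/
def kiteRootOfUnity (n : ℕ) : ℂ := Complex.exp (2 * Real.pi * Complex.I / ((n + 1 : ℕ) : ℂ))

theorem isPrimitiveRoot_kiteRootOfUnity (n : ℕ) : IsPrimitiveRoot (kiteRootOfUnity n) (n + 1) :=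
  Complex.isPrimitiveRoot_exp (n + 1) (by omega)

theorem kiteRootOfUnity_pow_add_inv (n j : ℕ) :
    kiteRootOfUnity n ^ j + (kiteRootOfUnity n ^ j)⁻¹ =
      ((2 * Real.cos (2 * Real.pi * j / (n + 1)) : ℝ) : ℂ) := by
  have h : kiteRootOfUnity n ^ j =
      Complex.exp (((2 * Real.pi * j / (n + 1) : ℝ) : ℂ) * Complex.I) := by
    rw [kiteRootOfUnity, ← Complex.exp_nat_mul]
    congr 1
    push_cast
    ring
  rw [h, ← Complex.exp_neg, ← neg_mul, ← Complex.two_cos, Complex.ofReal_mul,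
    Complex.ofReal_cos]
  rfl

/-- The exponents `j` and `n + 1 - j` give inverse roots of unity, hence the same sum; `b² ≠ 1`
excludes `j = 0` and `2 j = n + 1`. -/
theorem mem_kiteCosines_of_pow_eq_one {b : ℂ} (hb : b ^ (n + 1) = 1) (hb2 : b ^ 2 ≠ 1) :
    b + b⁻¹ ∈ kiteCosines n := by
  have hprim := isPrimitiveRoot_kiteRootOfUnity n
  obtain ⟨j, hj, rfl⟩ := hprim.eq_pow_of_pow_eq_one hb
  have hj0 : j ≠ 0 := by
    rintro rfl
    simp at hb2
  have hj2 : 2 * j ≠ n + 1 := by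
    intro h
    refine hb2 ?_
    rw [← pow_mul, mul_comm, h, hprim.pow_eq_one]
  rcases le_or_gt j (n / 2) with h | h
  · exact ⟨j, by omega, h, kiteRootOfUnity_pow_add_inv n j⟩
  · refine ⟨n + 1 - j, by omega, by omega, ?_⟩
    rw [← kiteRootOfUnity_pow_add_inv]
    have h1 : kiteRootOfUnity n ^ (n + 1 - j) * kiteRootOfUnity n ^ j = 1 := by
      rw [← pow_add, Nat.sub_add_cancel hj.le, hprim.pow_eq_one]
    rw [eq_inv_of_mul_eq_one_left h1, inv_inv, add_comm]

/-- Going once around, the invariant and `F 0 = F (n + 1) = 0` give `b ^ (n + 1) = 1`. If `b² = 1`,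
then `F k = k b ^ (k + 1) F 1` would not return to zero. -/
theorem cycle_mem_kiteCosines (hn : 2 ≤ n) [(SimpleGraph.cycleGraph (n + 1)).LocallyFinite]
    {z : ℂ} {f : Fin (n + 1) → ℂ} (hf : f ≠ 0) (hf0 : f 0 = 0)
    (hfz : ∀ v, shift (SimpleGraph.cycleGraph (n + 1)) f v = z * f v) : z ∈ kiteCosines n := by
  obtain ⟨b, hb0, -, rfl⟩ := exists_eq_add_inv z
  set F : ℕ → ℂ := fun k => f (k : Fin (n + 1)) with hF
  have hrec : ∀ k, F k + F (k + 2) = (b + b⁻¹) * F (k + 1) := fun k =>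
    (shift_cycleGraph hn f k).symm.trans (hfz _)
  have hF0 : F 0 = 0 := by simp [hF, hf0]
  have hFn : F (n + 1) = 0 := by
    simp only [hF]
    rw [natCast_self_add_one, hf0]
  have hFn2 : F (n + 2) = F 1 := by
    simp only [hF]
    rw [natCast_self_add_two, Nat.cast_one]
  have hF1 : F 1 ≠ 0 := by
    intro h1
    have hz : ∀ k, F k = 0 ∧ F (k + 1) = 0 := by
      intro k
      induction k with
      | zero => exact ⟨hF0, h1⟩
      | succ k ih =>
        refine ⟨ih.2, ?_⟩
        have h := hrec k
        rwa [ih.1, ih.2, zero_add, mul_zero] at h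
    refine hf (funext fun v => ?_)
    have h := (hz v.val).1
    simp only [hF, Fin.cast_val_eq_self] at h
    exact h
  have hpow : b ^ (n + 1) = 1 := by
    have h1 := recursion_sub_mul_eq (n := n) hb0 (fun k _ => hrec k) n le_rfl
    have h2 := hrec n
    rw [hFn, hFn2, mul_zero] at h2
    rw [hFn, hF0] at h1
    refine mul_right_cancel₀ hF1 ?_
    linear_combination h1 + b ^ (n + 1) * h2
  refine mem_kiteCosines_of_pow_eq_one hpow fun hb2 => ?_
  have hinv : b⁻¹ = b := by
    rw [inv_eq_iff_eq_inv, ← mul_left_inj' hb0, inv_mul_cancel₀ hb0, ← sq, hb2]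
  have hlin : ∀ k : ℕ, F k = k * b ^ (k + 1) * F 1 ∧ F (k + 1) = (k + 1) * b ^ (k + 2) * F 1 := by
    intro k
    induction k with
    | zero => exact ⟨by simp [hF0], by simp [hb2]⟩
    | succ k ih =>
      refine ⟨by rw [ih.2]; push_cast; ring, ?_⟩
      have h := hrec k
      rw [hinv, ih.1, ih.2] at h
      push_cast
      linear_combination h + (k * b ^ (k + 1) * F 1) * hb2
  have h := (hlin n).2
  rw [hFn, eq_comm, mul_eq_zero, or_iff_left hF1, mul_eq_zero,
    or_iff_left (pow_ne_zero _ hb0)] at h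
  exact (by exact_mod_cast n.succ_ne_zero : (n : ℂ) + 1 ≠ 0) h

theorem exists_cycle_solution_of_mem_kiteCosines (hn : 2 ≤ n)
    [(SimpleGraph.cycleGraph (n + 1)).LocallyFinite] {z : ℂ} (hz : z ∈ kiteCosines n) :
    ∃ f : Fin (n + 1) → ℂ, f ≠ 0 ∧ f 0 = 0 ∧
      ∀ v, shift (SimpleGraph.cycleGraph (n + 1)) f v = z * f v := by
  obtain ⟨j, hj1, hj2, rfl⟩ := hz
  rw [← kiteRootOfUnity_pow_add_inv]
  have hprim := isPrimitiveRoot_kiteRootOfUnity n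
  set b := kiteRootOfUnity n ^ j with hb
  have hbN : b ^ (n + 1) = 1 := by
    rw [hb, ← pow_mul, mul_comm, pow_mul, hprim.pow_eq_one, one_pow]
  have hb0 : b ≠ 0 := by
    rintro h
    rw [h, zero_pow (by omega)] at hbN
    exact zero_ne_one hbN
  have hb2 : b ^ 2 ≠ 1 := by
    rw [hb, ← pow_mul, Ne, hprim.pow_eq_one_iff_dvd]
    intro h
    have := Nat.le_of_dvd (by omega) h
    omega
  -- The sine-type solution: periodic since `b ^ (n + 1) = 1`, nonzero since `b² ≠ 1`.
  set f : Fin (n + 1) → ℂ := fun v => b ^ v.val - b⁻¹ ^ v.val with hf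
  have hcast : ∀ k : ℕ, f (k : Fin (n + 1)) = b ^ k - b⁻¹ ^ k := by
    intro k
    simp only [hf, Fin.val_natCast]
    rw [← pow_eq_pow_mod k hbN, ← pow_eq_pow_mod k (by rw [inv_pow, hbN, inv_one])]
  refine ⟨f, fun h => ?_, by simp [hf], fun v => ?_⟩
  · have h1 := hcast 1
    rw [h, pow_one, pow_one, Pi.zero_apply] at h1
    refine hb2 ?_
    have h2 : b = b⁻¹ := (sub_eq_zero.1 h1.symm)
    rw [sq]
    nth_rewrite 2 [h2]
    exact mul_inv_cancel₀ hb0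
  · have hv : v = ((v.val + n + 1 : ℕ) : Fin (n + 1)) := by
      rw [add_assoc, Nat.cast_add, natCast_self_add_one, add_zero, Fin.cast_val_eq_self]
    rw [hv, shift_cycleGraph hn, hcast, hcast, hcast]
    generalize v.val + n = k
    rw [inv_pow, inv_pow, inv_pow]
    field_simp
    ring

/-- The recursion holds at all vertices but `v₀`. Its invariants for `b` and for `b⁻¹` relate `F 1`
and `F n`; the equation at `v₀` adds `F 1 + F n = b⁻¹`, and elimination leaves the polynomial. -/
theorem cycle_root_of_solution (hn : 2 ≤ n) [(SimpleGraph.cycleGraph (n + 1)).LocallyFinite]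
    {b : ℂ} (hb0 : b ≠ 0) {f : Fin (n + 1) → ℂ} (hf0 : f 0 = 1)
    (hfz : shift (SimpleGraph.cycleGraph (n + 1)) f 0 + b = (b + b⁻¹) * f 0)
    (hH : ∀ v, v ≠ 0 → shift (SimpleGraph.cycleGraph (n + 1)) f v = (b + b⁻¹) * f v) :
    b ^ (n + 1) + 2 * b ^ 2 - 1 = 0 := by
  set F : ℕ → ℂ := fun k => f (k : Fin (n + 1)) with hF
  have hrec : ∀ k, k < n → F k + F (k + 2) = (b + b⁻¹) * F (k + 1) := fun k hk =>
    (shift_cycleGraph hn f k).symm.trans (hH _ (natCast_succ_ne_zero hk))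
  have hF0 : F 0 = 1 := by simp [hF, hf0]
  have hFn : F (n + 1) = 1 := by
    simp only [hF]
    rw [natCast_self_add_one, hf0]
  have hsum : F n + F 1 + b = b + b⁻¹ := by
    have h := shift_cycleGraph hn f n
    rw [natCast_self_add_one, natCast_self_add_two] at h
    rw [h, hf0, mul_one] at hfz
    simpa [hF] using hfz
  have h1 := recursion_sub_mul_eq hb0 hrec n le_rfl
  have h2 := recursion_sub_mul_eq (a := F) (inv_ne_zero hb0) (n := n)
    (fun k hk => by rw [inv_inv, add_comm b⁻¹]; exact hrec k hk) n le_rfl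
  rw [hF0, hFn] at h1 h2
  set s := F 1
  set t := F n
  have hsum' : b * (s + t) = 1 := by
    have : s + t = b⁻¹ := by linear_combination hsum
    rw [this, mul_inv_cancel₀ hb0]
  have h2' : b - t = b ^ n * (b * s - 1) := by
    rw [inv_pow] at h2
    field_simp at h2
    linear_combination h2
  linear_combination b * h1 + b * h2' + (1 + b ^ (n + 1)) * hsum'

theorem exists_cycle_solution_of_root (hn : 2 ≤ n)
    [(SimpleGraph.cycleGraph (n + 1)).LocallyFinite]
    {b : ℂ} (hb0 : b ≠ 0) (hb : ‖b‖ < 1) (hroot : b ^ (n + 1) + 2 * b ^ 2 - 1 = 0) :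
    ∃ f : Fin (n + 1) → ℂ, f 0 = 1 ∧
      shift (SimpleGraph.cycleGraph (n + 1)) f 0 + b = (b + b⁻¹) * f 0 ∧
      ∀ v, v ≠ 0 → shift (SimpleGraph.cycleGraph (n + 1)) f v = (b + b⁻¹) * f v := by
  have hd : 1 + b ^ (n + 1) ≠ 0 := by
    intro h
    have h1 : ‖b‖ ^ (n + 1) = 1 := by
      rw [← norm_pow, eq_neg_of_add_eq_zero_right h, norm_neg, norm_one]
    exact absurd h1 (pow_lt_one₀ (norm_nonneg b) hb (by omega)).ne
  obtain ⟨d, hd'⟩ : ∃ d, d * (1 + b ^ (n + 1)) = 1 := ⟨_, inv_mul_cancel₀ hd⟩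
  -- The solution symmetric under `v ↦ n + 1 - v`, normalised at `v₀`; the symmetry makes the
  -- formula valid also at `n + 1`.
  set f : Fin (n + 1) → ℂ := fun v => d * (b ^ v.val + b ^ (n + 1 - v.val)) with hf
  have hcast : ∀ k : ℕ, k ≤ n + 1 → f (k : Fin (n + 1)) = d * (b ^ k + b ^ (n + 1 - k)) := by
    intro k hk
    rcases hk.lt_or_eq with h | rfl
    · simp only [hf, Fin.val_natCast, Nat.mod_eq_of_lt h]
    · rw [natCast_self_add_one]
      simp only [hf, Fin.val_zero, Nat.sub_zero, Nat.sub_self]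
      ring
  have hf0 : f 0 = 1 := by
    simp only [hf, Fin.val_zero, Nat.sub_zero, pow_zero]
    exact hd'
  refine ⟨f, hf0, ?_, fun v hv => ?_⟩
  · have h := shift_cycleGraph hn f n
    rw [natCast_self_add_one, natCast_self_add_two, hcast n (by omega),
      show (1 : Fin (n + 1)) = ((1 : ℕ) : Fin (n + 1)) from Nat.cast_one.symm,
      hcast 1 (by omega), Nat.add_sub_cancel_left, Nat.add_sub_cancel] at h
    rw [h, hf0]
    field_simp
    linear_combination hd' + d * hroot
  · obtain ⟨k, hk, rfl⟩ := exists_natCast_eq v hv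
    rw [shift_cycleGraph hn, hcast k (by omega), hcast (k + 1) (by omega),
      hcast (k + 2) (by omega)]
    obtain ⟨t, ht⟩ : ∃ t, n + 1 = k + 2 + t := ⟨n + 1 - (k + 2), by omega⟩
    rw [show n + 1 - k = t + 2 by omega, show n + 1 - (k + 1) = t + 1 by omega,
      show n + 1 - (k + 2) = t by omega]
    field_simp
    ring

theorem finiteSystemEigenvalues_cycleGraph (hn : 2 ≤ n)
    [(SimpleGraph.cycleGraph (n + 1)).LocallyFinite] :
    finiteSystemEigenvalues (SimpleGraph.cycleGraph (n + 1)) 0 = kiteCosines n ∪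
      (fun x : ℝ => ((x + 1 / x : ℝ) : ℂ)) ''
        {x : ℝ | x ∈ Set.Ioo (-1) 1 ∧ x ^ (n + 1) + 2 * x ^ 2 - 1 = 0} := by
  ext z
  constructor
  · rintro (⟨f, hf, hf0, hfz⟩ | ⟨b, hb0, hb, hz, f, hf0, hfz, hH⟩)
    · exact Or.inl (cycle_mem_kiteCosines hn hf hf0 hfz)
    · right
      -- Self-adjointness of `H` rules out nonreal roots in the disc, so only real roots have to be
      -- counted.
      have him := im_eq_zero_of_finiteSystem _ _ hb0 hb hz hf0 hfz hH
      rw [one_div] at hz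
      subst hz
      have hroot := cycle_root_of_solution hn hb0 hf0 hfz hH
      obtain ⟨x, rfl⟩ : ∃ x : ℝ, b = x := ⟨b.re, Complex.ext rfl (by simpa using him)⟩
      refine ⟨x, ⟨?_, by exact_mod_cast hroot⟩, by push_cast; rw [one_div]⟩
      rw [Complex.norm_real, Real.norm_eq_abs, abs_lt] at hb
      exact hb
  · rintro (hz | ⟨x, ⟨hx, hroot⟩, rfl⟩)
    · exact Or.inl (exists_cycle_solution_of_mem_kiteCosines hn hz)
    · right
      have hx0 : x ≠ 0 := by
        rintro rfl
        simp at hroot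
      have hb0 : (x : ℂ) ≠ 0 := Complex.ofReal_ne_zero.2 hx0
      have hb : ‖(x : ℂ)‖ < 1 := by
        rw [Complex.norm_real, Real.norm_eq_abs, abs_lt]
        exact hx
      have hz : ((x + 1 / x : ℝ) : ℂ) = (x : ℂ) + 1 / (x : ℂ) := by push_cast; rfl
      refine ⟨x, hb0, hb, hz, ?_⟩
      beta_reduce
      rw [hz, one_div]
      exact exists_cycle_solution_of_root hn hb0 hb (by exact_mod_cast hroot)

theorem kiteCosines_two : kiteCosines 2 = {-1} := by
  have h : (2 * Real.cos (2 * Real.pi * (1 : ℕ) / ((2 : ℕ) + 1)) : ℝ) = -1 := by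
    rw [show 2 * Real.pi * (1 : ℕ) / ((2 : ℕ) + 1) = Real.pi - Real.pi / 3 by push_cast; ring,
      Real.cos_pi_sub, Real.cos_pi_div_three]
    norm_num
  ext z
  rw [Set.mem_singleton_iff]
  constructor
  · rintro ⟨j, hj1, hj2, rfl⟩
    obtain rfl : j = 1 := by omega
    rw [h]
    simp
  · rintro rfl
    refine ⟨1, le_rfl, le_rfl, ?_⟩
    rw [h]
    simp

theorem finiteSystemEigenvalues_triangle [(SimpleGraph.cycleGraph (2 + 1)).LocallyFinite] :
    finiteSystemEigenvalues (SimpleGraph.cycleGraph (2 + 1)) 0 =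
      {-1, ((Real.sqrt 5 : ℝ) : ℂ)} := by
  have h5 : Real.sqrt 5 ^ 2 = 5 := Real.sq_sqrt (by norm_num)
  have h5l : 2 < Real.sqrt 5 := by
    rw [Real.lt_sqrt (by norm_num)]
    norm_num
  have h5u : Real.sqrt 5 < 3 := by
    rw [Real.sqrt_lt' (by norm_num)]
    norm_num
  have hset : {x : ℝ | x ∈ Set.Ioo (-1) 1 ∧ x ^ (2 + 1) + 2 * x ^ 2 - 1 = 0} =
      {(Real.sqrt 5 - 1) / 2} := by
    ext x
    rw [Set.mem_ofPred_eq, Set.mem_singleton_iff]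
    constructor
    · rintro ⟨hx, h⟩
      -- From `x³ + 2 x² - 1 = (x + 1)(x² + x - 1)`; the other two roots are at most `-1`.
      have h1 : (x + 1) * ((2 * x + 1 + Real.sqrt 5) * (2 * x + 1 - Real.sqrt 5)) = 0 := by
        linear_combination 4 * h - (x + 1) * h5
      rcases mul_eq_zero.1 h1 with h2 | h2
      · linarith [hx.1]
      · rcases mul_eq_zero.1 h2 with h3 | h3
        · linarith [hx.1]
        · linarith
    · rintro rfl
      refine ⟨⟨by linarith, by linarith⟩, ?_⟩
      linear_combination ((Real.sqrt 5 - 1) / 8 + 1 / 4) * h5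
  rw [finiteSystemEigenvalues_cycleGraph le_rfl, kiteCosines_two, hset, Set.image_singleton]
  have hval : (Real.sqrt 5 - 1) / 2 + 1 / ((Real.sqrt 5 - 1) / 2) = Real.sqrt 5 := by
    have : Real.sqrt 5 - 1 ≠ 0 := by linarith
    field_simp
    linear_combination -h5
  rw [hval]
  rfl

end Cycle

end InfiniteTail

end

open InfiniteTail in
theorem mainTheorem12 (p : ℝ≥0∞) [Fact (1 ≤ p)] :
    -- the infinite tail
    (spectrum ℂ (tailShift p) = band ∧ essentialSpectrum (tailShift p) = band) ∧
    -- an arbitrary finite graph with an infinite tail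
    (∀ (V : Type*) [Fintype V] (H : SimpleGraph V) [DecidableRel H.Adj] (v₀ : V),
      essentialSpectrum (attachTailShift H v₀ p) = band ∧
      spectrum ℂ (attachTailShift H v₀ p) = band ∪ pointSpectrum (attachTailShift H v₀ p) ∧
      (p ≠ ∞ → pointSpectrum (attachTailShift H v₀ p) = finiteSystemEigenvalues H v₀) ∧
      spectrum ℂ (attachTailShift H v₀ p) = band ∪ finiteSystemEigenvalues H v₀) ∧
    -- the kite over the triangle
    ((p ≠ ∞ → pointSpectrum (kiteShift 2 p) = {-1, ((Real.sqrt 5 : ℝ) : ℂ)}) ∧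
      spectrum ℂ (kiteShift 2 p) = band ∪ {-1, ((Real.sqrt 5 : ℝ) : ℂ)}) ∧
    -- the kite over a longer cycle
    (∀ n : ℕ, 3 ≤ n → ∃ x₁ ∈ Set.Ioo (0 : ℝ) 1, ∃ x₂ ∈ Set.Ioo (-1 : ℝ) 0,
      {x : ℝ | x ∈ Set.Ioo (-1) 1 ∧ x ^ (n + 1) + 2 * x ^ 2 - 1 = 0} = {x₁, x₂} ∧
      (p ≠ ∞ → pointSpectrum (kiteShift n p) =
        kiteCosines n ∪ {((x₁ + 1 / x₁ : ℝ) : ℂ), ((x₂ + 1 / x₂ : ℝ) : ℂ)}) ∧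
      spectrum ℂ (kiteShift n p) =
        band ∪ (kiteCosines n ∪ {((x₁ + 1 / x₁ : ℝ) : ℂ), ((x₂ + 1 / x₂ : ℝ) : ℂ)})) ∧
    -- the fly-swatter
    (∀ n : ℕ, 2 ≤ n →
      (p ≠ ∞ → pointSpectrum (flySwatterShift n p) =
        {-1, ((flySwatterRoot n + 1 / flySwatterRoot n : ℝ) : ℂ)}) ∧
      spectrum ℂ (flySwatterShift n p) =
        band ∪ {-1, ((flySwatterRoot n + 1 / flySwatterRoot n : ℝ) : ℂ)}) ∧
    -- the comb with an infinite tail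
    (∀ (n : ℕ) (hn : 2 ≤ n),
      (p ≠ ∞ → pointSpectrum (combShift n hn p) = combEigenvalues n) ∧
      spectrum ℂ (combShift n hn p) = band ∪ combEigenvalues n) := by
  classical
  refine ⟨⟨spectrum_tailShift p, essentialSpectrum_tailShift p⟩, ?_, ?_, ?_, ?_, ?_⟩
  · intro V _ H _ v₀
    exact ⟨essentialSpectrum_attachTailShift H v₀ p,
      spectrum_attachTailShift_eq_union_pointSpectrum H v₀ p,
      pointSpectrum_attachTailShift H v₀ p, spectrum_attachTailShift H v₀ p⟩
  · rw [← finiteSystemEigenvalues_triangle]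
    exact ⟨pointSpectrum_attachTailShift _ _ p, spectrum_attachTailShift _ _ p⟩
  · intro n hn
    obtain ⟨x₁, hx₁, x₂, hx₂, hset⟩ := exists_kite_roots (by omega : 4 ≤ n + 1)
    refine ⟨x₁, hx₁, x₂, hx₂, hset, ?_⟩
    have h := finiteSystemEigenvalues_cycleGraph (by omega : 2 ≤ n)
    rw [hset, Set.image_pair] at h
    rw [← h]
    exact ⟨pointSpectrum_attachTailShift _ _ p, spectrum_attachTailShift _ _ p⟩
  · intro n hn
    rw [← finiteSystemEigenvalues_top hn]
    exact ⟨pointSpectrum_attachTailShift _ _ p, spectrum_attachTailShift _ _ p⟩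
  · intro n hn
    rw [← finiteSystemEigenvalues_comb hn]
    exact ⟨pointSpectrum_attachTailShift _ _ p, spectrum_attachTailShift _ _ p⟩
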